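/- Let $\mathbb{K}=\mathbb{C}(\mathsf u,\mathsf v)$ with $\mathsf u,\mathsf v$ indeterminates, and let $n\ge 1$. Let $\mathcal{E}_n^{\mathtt B}$ be the unital associative $\mathbb{K}$-algebra generated by $B_1$, $T_1,\dots,T_{n-1}$, $E_1,\dots,E_{n-1}$, $F_1,\dots,F_n$ subject to the following relations (for all indices for which they make sense): $$\begin{aligned} &T_iT_j=T_jT_i\ (|i-j|>1),\quad T_iT_{i+1}T_i=T_{i+1}T_iT_{i+1},\quad T_i^2=1+(\mathsf u-\mathsf u^{-1})E_iT_i,\\ &E_i^2=E_i,\quad E_iE_j=E_jE_i,\quad E_iT_i=T_iE_i,\quad E_iT_j=T_jE_i\ (|i-j|>1),\\ &E_iE_jT_i=T_iE_iE_j=E_jT_iE_j,\quad E_iT_jT_i=T_jT_iE_j\ (|i-j|=1),\\ &B_1T_1B_1T_1=T_1B_1T_1B_1,\quad B_1T_i=T_iB_1\ (i>1),\quad B_1^2=1+(\mathsf v-\mathsf v^{-1})F_1B_1,\quad B_1E_i=E_iB_1,\\ &F_i^2=F_i,\quad B_1F_j=F_jB_1,\quad F_iE_j=E_jF_i,\quad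 F_jT_i=T_iF_{s_i(j)}\ (s_i=(i,i+1)),\quad E_iF_i=F_iF_{i+1}=E_iF_{i+1}. \end{aligned}$$ (For $n=1$ the generators are $B_1,F_1$.) The $T_i$ are invertible. For $k\ge 2$ put $B_k=T_{k-1}\cdots T_1B_1T_1^{-1}\cdots T_{k-1}^{-1}$, and define inductively $$\mathsf M_1=\{1,B_1\},\qquad \mathsf M_k=\{1,\ B_k\}\cup\{T_{k-1}x : x\in \mathsf M_{k-1}\}\quad(2\le k\le n).$$ For $1\le i<j\le n$ put $E_{i,j}=T_i\cdots T_{j-2}E_{j-1}T_{j-2}^{-1}\cdots T_i^{-1}$ (so $E_{i,i+1}=E_i$); for $\emptyset\ne J\subseteq\{1,\dots,n\}$ put $E_J=\prod_{i<j;\ i,j\in J}E_{i,j}$, and for $A\subseteq\{1,\dots,n\}$ put $F_A=\prod_{i\in A}F_i$. For a set partition $I=\{I_0,I_1,\dots,I_m\}$ of $\{0,1,\dots,n\}$ with $0\in I_0$, put $EF_I=E_{I_1}\cdots E_{I_m}F_{I_0\setminus\{0\}}$. (In these products the factors commute; to fix the definition, they are taken in lexicographic order in $E_J$, in increasing order in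 $F_A$, and with $I_1,\dots,I_m$ ordered by their least elements.) Let $\mathsf P(\mathbf n_0)$ be the set of all set partitions of $\{0,1,\dots,n\}$. Then the set $$\mathcal C_n=\{EF_I\,\mathtt m_1\cdots\mathtt m_n \mid I\in\mathsf P(\mathbf n_0),\ \mathtt m_i\in\mathsf M_i\ (1\le i\le n)\}$$ is a basis of the $\mathbb{K}$-vector space $\mathcal{E}_n^{\mathtt B}$, and distinct tuples $(I,\mathtt m_1,\dots,\mathtt m_n)$ give distinct elements of $\mathcal C_n$. -/

import Mathlib

namespace BTB

noncomputable section

/-- The field `𝕂 = ℂ(u, v)` of rational functions in two indeterminates. -/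
abbrev K : Type := FractionRing (MvPolynomial (Fin 2) ℂ)

/-- The indeterminate `u`. -/
def u : K := algebraMap (MvPolynomial (Fin 2) ℂ) K (MvPolynomial.X 0)

/-- The indeterminate `v`. -/
def v : K := algebraMap (MvPolynomial (Fin 2) ℂ) K (MvPolynomial.X 1)

/-- The generators `B₁`, `T₁, …, T_{n-1}`, `E₁, …, E_{n-1}`, `F₁, …, F_n`. -/
inductive Gen (n : ℕ) : Type
  | B : Gen n
  | T (i : ℕ) (h : 1 ≤ i ∧ i < n) : Gen n
  | E (i : ℕ) (h : 1 ≤ i ∧ i < n) : Gen n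
  | F (j : ℕ) (h : 1 ≤ j ∧ j ≤ n) : Gen n

/-- The free unital associative `𝕂`-algebra on the generators. -/
abbrev Free (n : ℕ) : Type := FreeAlgebra K (Gen n)

namespace Free

/-- The free generator `B₁`. -/
def b (n : ℕ) : Free n := FreeAlgebra.ι K Gen.B

/-- The free generator `T_i`, `1 ≤ i ≤ n - 1` (by convention `1` for other `i`). -/
def t (n i : ℕ) : Free n :=
  if h : 1 ≤ i ∧ i < n then FreeAlgebra.ι K (Gen.T i h) else 1

/-- The free generator `E_i`, `1 ≤ i ≤ n - 1` (by convention `1` for other `i`). -/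
def e (n i : ℕ) : Free n :=
  if h : 1 ≤ i ∧ i < n then FreeAlgebra.ι K (Gen.E i h) else 1

/-- The free generator `F_j`, `1 ≤ j ≤ n` (by convention `1` for other `j`). -/
def f (n j : ℕ) : Free n :=
  if h : 1 ≤ j ∧ j ≤ n then FreeAlgebra.ι K (Gen.F j h) else 1

end Free

open Free in
/-- The defining relations of the bt-algebra of type `B`. For `n = 1` only the relations
`quadB`, `idemF` and `commBF` (and trivial ones) are left. -/
inductive Rel (n : ℕ) : Free n → Free n → Prop
  | commT (i j : ℕ) (hi : 1 ≤ i ∧ i < n) (hj : 1 ≤ j ∧ j < n) (h : 1 < |(i : ℤ) - j|) :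
      Rel n (t n i * t n j) (t n j * t n i)
  | braidT (i : ℕ) (hi : 1 ≤ i ∧ i + 1 < n) :
      Rel n (t n i * t n (i + 1) * t n i) (t n (i + 1) * t n i * t n (i + 1))
  | quadT (i : ℕ) (hi : 1 ≤ i ∧ i < n) :
      Rel n (t n i * t n i) (1 + (u - u⁻¹) • (e n i * t n i))
  | idemE (i : ℕ) (hi : 1 ≤ i ∧ i < n) :
      Rel n (e n i * e n i) (e n i)
  | commE (i j : ℕ) (hi : 1 ≤ i ∧ i < n) (hj : 1 ≤ j ∧ j < n) :
      Rel n (e n i * e n j) (e n j * e n i)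
  | commET (i : ℕ) (hi : 1 ≤ i ∧ i < n) :
      Rel n (e n i * t n i) (t n i * e n i)
  | commET' (i j : ℕ) (hi : 1 ≤ i ∧ i < n) (hj : 1 ≤ j ∧ j < n) (h : 1 < |(i : ℤ) - j|) :
      Rel n (e n i * t n j) (t n j * e n i)
  | eet (i j : ℕ) (hi : 1 ≤ i ∧ i < n) (hj : 1 ≤ j ∧ j < n) (h : |(i : ℤ) - j| = 1) :
      Rel n (e n i * e n j * t n i) (t n i * e n i * e n j)
  | tee (i j : ℕ) (hi : 1 ≤ i ∧ i < n) (hj : 1 ≤ j ∧ j < n) (h : |(i : ℤ) - j| = 1) :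
      Rel n (t n i * e n i * e n j) (e n j * t n i * e n j)
  | ett (i j : ℕ) (hi : 1 ≤ i ∧ i < n) (hj : 1 ≤ j ∧ j < n) (h : |(i : ℤ) - j| = 1) :
      Rel n (e n i * t n j * t n i) (t n j * t n i * e n j)
  | braidB (h : 1 < n) :
      Rel n (b n * t n 1 * b n * t n 1) (t n 1 * b n * t n 1 * b n)
  | commBT (i : ℕ) (hi : 1 < i ∧ i < n) :
      Rel n (b n * t n i) (t n i * b n)
  | quadB :
      Rel n (b n * b n) (1 + (v - v⁻¹) • (f n 1 * b n))
  | commBE (i : ℕ) (hi : 1 ≤ i ∧ i < n) :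
      Rel n (b n * e n i) (e n i * b n)
  | idemF (i : ℕ) (hi : 1 ≤ i ∧ i ≤ n) :
      Rel n (f n i * f n i) (f n i)
  | commBF (j : ℕ) (hj : 1 ≤ j ∧ j ≤ n) :
      Rel n (b n * f n j) (f n j * b n)
  | commFE (i j : ℕ) (hi : 1 ≤ i ∧ i ≤ n) (hj : 1 ≤ j ∧ j < n) :
      Rel n (f n i * e n j) (e n j * f n i)
  | permF (i j : ℕ) (hi : 1 ≤ i ∧ i < n) (hj : 1 ≤ j ∧ j ≤ n) :
      Rel n (f n j * t n i) (t n i * f n (Equiv.swap i (i + 1) j))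
  | efLeft (i : ℕ) (hi : 1 ≤ i ∧ i < n) :
      Rel n (e n i * f n i) (f n i * f n (i + 1))
  | efRight (i : ℕ) (hi : 1 ≤ i ∧ i < n) :
      Rel n (f n i * f n (i + 1)) (e n i * f n (i + 1))

/-- The bt-algebra of type `B`, for `n ≥ 1`. -/
def Alg (n : ℕ) : Type := RingQuot (Rel n)

instance (n : ℕ) : Ring (Alg n) := inferInstanceAs (Ring (RingQuot (Rel n)))

instance (n : ℕ) : Algebra K (Alg n) := inferInstanceAs (Algebra K (RingQuot (Rel n)))

/-- The quotient map from the free algebra. -/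
def proj (n : ℕ) : Free n →ₐ[K] Alg n := RingQuot.mkAlgHom K (Rel n)

/-- The element `B₁` of the algebra. -/
def B₁ (n : ℕ) : Alg n := proj n (Free.b n)

/-- The elements `T_i` of the algebra. -/
def T (n i : ℕ) : Alg n := proj n (Free.t n i)

/-- The elements `E_i` of the algebra. -/
def E (n i : ℕ) : Alg n := proj n (Free.e n i)

/-- The elements `F_j` of the algebra. -/
def F (n j : ℕ) : Alg n := proj n (Free.f n j)

theorem proj_rel {n : ℕ} {x y : Free n} (h : Rel n x y) : proj n x = proj n y :=
  RingQuot.mkAlgHom_rel K h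

theorem T_sq {n i : ℕ} (hi : 1 ≤ i ∧ i < n) :
    T n i * T n i = 1 + (u - u⁻¹) • (E n i * T n i) := by
  simpa [T, E] using proj_rel (Rel.quadT i hi)

theorem E_mul_T {n i : ℕ} (hi : 1 ≤ i ∧ i < n) : E n i * T n i = T n i * E n i := by
  simpa [T, E] using proj_rel (Rel.commET i hi)

/-- `T_i` as a unit of the algebra, with inverse `T_i - (u - u⁻¹) E_i`. -/
def Tu (n i : ℕ) : (Alg n)ˣ :=
  if hi : 1 ≤ i ∧ i < n then
    { val := T n i
      inv := T n i - (u - u⁻¹) • E n i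
      val_inv := by
        rw [mul_sub, T_sq hi, mul_smul_comm, E_mul_T hi, add_sub_cancel_right]
      inv_val := by
        rw [sub_mul, T_sq hi, smul_mul_assoc, add_sub_cancel_right] }
  else 1

theorem Tu_val (n i : ℕ) : (Tu n i : Alg n) = T n i := by
  unfold Tu
  split_ifs with h
  · rfl
  · simp [T, Free.t, h]

/-- The elements `B_k = T_{k-1} ⋯ T₁ B₁ T₁⁻¹ ⋯ T_{k-1}⁻¹`, through
`B_k = T_{k-1} B_{k-1} T_{k-1}⁻¹` (the value at `k = 0` is not used). -/
def Bk (n : ℕ) : ℕ → Alg n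
  | 0 => B₁ n
  | 1 => B₁ n
  | k + 2 => T n (k + 1) * Bk n (k + 1) * ((Tu n (k + 1))⁻¹ : (Alg n)ˣ)

/-- The sets `M₁ = {1, B₁}` and `M_k = {1, B_k, T_{k-1} x : x ∈ M_{k-1}}` for `k ≥ 2`
(the value at `k = 0` is not used). -/
def M (n : ℕ) : ℕ → Set (Alg n)
  | 0 => {1}
  | 1 => {1, Bk n 1}
  | k + 2 => {1, Bk n (k + 2)} ∪ {y | ∃ x ∈ M n (k + 1), y = T n (k + 1) * x}

/-- `Eaux n d i = T_i ⋯ T_{i+d-1} E_{i+d} T_{i+d-1}⁻¹ ⋯ T_i⁻¹`. -/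
def Eaux (n : ℕ) : ℕ → ℕ → Alg n
  | 0, i => E n i
  | d + 1, i => T n i * Eaux n d (i + 1) * ((Tu n i)⁻¹ : (Alg n)ˣ)

/-- For `i < j`: `E_{i,j} = T_i ⋯ T_{j-2} E_{j-1} T_{j-2}⁻¹ ⋯ T_i⁻¹`, so `E_{i,i+1} = E_i`. -/
def Eij (n i j : ℕ) : Alg n := Eaux n (j - i - 1) i

/-- `E_J`, the product of the `E_{i,j}` over the pairs `i < j` of elements of `J`, taken in
lexicographic order (these elements commute); it is `1` if `J` has at most one element. -/
def EJ (n : ℕ) (J : Finset ℕ) : Alg n :=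
  (((J.sort (· ≤ ·)).map fun i =>
    (((J.filter fun j => i < j).sort (· ≤ ·)).map fun j => Eij n i j).prod)).prod

/-- `F_A`, the product of the `F_i`, `i ∈ A`, in increasing order (these elements commute). -/
def FA (n : ℕ) (A : Finset ℕ) : Alg n := ((A.sort (· ≤ ·)).map fun i => F n i).prod

/-- The set partitions of `{0, 1, …, n}`. -/
abbrev P₀ (n : ℕ) : Type := Finpartition (Finset.range (n + 1))

/-- The least elements of the blocks of `I` that do not contain `0`. -/
def mins {n : ℕ} (I : P₀ n) : Finset ℕ :=
  (Finset.range (n + 1)).filter fun i => 0 ∉ I.part i ∧ ∀ j ∈ I.part i, i ≤ j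

/-- `EF_I`: the product of the `E_J` over the blocks `J` of `I` that do not contain `0` (in
increasing order of their least elements), times `F_A`, where `A ∪ {0}`, `0 ∉ A`, is the block
of `0`. -/
def EF {n : ℕ} (I : P₀ n) : Alg n :=
  (((mins I).sort (· ≤ ·)).map fun i => EJ n (I.part i)).prod * FA n ((I.part 0).erase 0)

/-- The element `EF_I m₁ ⋯ m_n`, where `m k` stands for `m_{k+1} ∈ M_{k+1}`, `0 ≤ k < n`. -/
def elt (n : ℕ) (p : P₀ n × ((k : Fin n) → M n (k + 1))) : Alg n :=
  EF p.1 * (List.ofFn fun k : Fin n => (p.2 k : Alg n)).prod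

/-- The set `C_n = {EF_I m₁ ⋯ m_n : I ∈ P({0, …, n}), m_i ∈ M_i}`. -/
def C (n : ℕ) : Set (Alg n) := Set.range (elt n)

end

end BTB

/-! Spanning. Write e_{ab} (`ee`) for the idempotent of a pair in {0,…,n}: F_j for {0,j} and E_{i,j}
for 1 ≤ i < j. Conjugation by T_k permutes the e_{ab} as the transposition (k,k+1) permutes indices,
so an identity among them need only be checked at small indices, where it follows from the defining
relations. They commute, and e_{ab}e_{bc} = e_{ab}e_{ac}. Hence a product of them depends only on
the equivalence relation its pairs generate, and these products are exactly the EF_I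
(`pairMonoid_eq_range`). Let A_k be generated by all e_{ab}, by B_1 if k ≥ 1, and by T_1,…,T_{k-1}.
Then A_{k+1} = A_k · span M_{k+1} (`partialAlg_eq_stepSpan`), because the right side contains 1 and
is stable under right multiplication by the generators; the delicate product is B_{k+2}B_1
(`Bk_mul_B_sub_mem`). Iterating up to A_n, which is the whole algebra, shows that C_n spans.

Independence. The algebra acts on functions of colored signed words (`rep`): E_i and F_j restrict to
words with two equal colors, while T_i and B_1 act by a swap and a sign change plus a Hecke-type
correction, present only where the colors agree. Testing the elements of C_n against delta functions
gives a square matrix in q = u − u⁻¹ and p = v − v⁻¹, compatible with ring homomorphisms. At u = v =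
1 the corrections vanish, different products m_1⋯m_n give different signed permutations
(`eq_of_act_eq`), and the matrix is unitriangular for refinement of partitions. So its determinant
is nonzero over 𝕂 (`det_testMatrix_ne_zero`). Indexing by labels rather than elements gives the
distinctness of the elements at the same time. -/

namespace BTB

/-! ### The defining relations inside the algebra -/

section Relations

variable {n : ℕ}

theorem isUnit_T (n i : ℕ) : IsUnit (T n i) := ⟨Tu n i, Tu_val n i⟩

theorem Tu_inv_mul_T (n i : ℕ) : ((Tu n i)⁻¹ : (Alg n)ˣ) * T n i = 1 := by
  rw [← Tu_val, Units.inv_mul]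

theorem T_mul_Tu_inv (n i : ℕ) : T n i * ((Tu n i)⁻¹ : (Alg n)ˣ) = 1 := by
  rw [← Tu_val, Units.mul_inv]

theorem Tu_inv {i : ℕ} (hi : 1 ≤ i ∧ i < n) :
    (((Tu n i)⁻¹ : (Alg n)ˣ) : Alg n) = T n i - (u - u⁻¹) • E n i := by
  unfold Tu
  rw [dif_pos hi]
  rfl

theorem semiconjBy_Tu_inv_right {x : Alg n} {i j : ℕ} (h : SemiconjBy x (T n i) (T n j)) :
    SemiconjBy x (((Tu n i)⁻¹ : (Alg n)ˣ) : Alg n) (((Tu n j)⁻¹ : (Alg n)ˣ) : Alg n) := by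
  refine SemiconjBy.units_inv_right ?_
  rwa [Tu_val, Tu_val]

theorem semiconjBy_Tu_inv_left {x y : Alg n} {i : ℕ} (h : SemiconjBy (T n i) x y) :
    SemiconjBy (((Tu n i)⁻¹ : (Alg n)ˣ) : Alg n) y x := by
  refine SemiconjBy.units_inv_symm_left ?_
  rwa [Tu_val]

theorem commute_T_T {i j : ℕ} (hi : 1 ≤ i ∧ i < n) (hj : 1 ≤ j ∧ j < n)
    (h : i + 1 < j ∨ j + 1 < i) : Commute (T n i) (T n j) := by
  have := proj_rel (Rel.commT i j hi hj (by rw [lt_abs]; omega))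
  simpa [T, commute_iff_eq] using this

theorem braid_T {i : ℕ} (hi : 1 ≤ i ∧ i + 1 < n) :
    T n i * T n (i + 1) * T n i = T n (i + 1) * T n i * T n (i + 1) := by
  simpa [T] using proj_rel (Rel.braidT i hi)

theorem E_mul_self {i : ℕ} (hi : 1 ≤ i ∧ i < n) : E n i * E n i = E n i := by
  simpa [E] using proj_rel (Rel.idemE i hi)

theorem commute_E_E {i j : ℕ} (hi : 1 ≤ i ∧ i < n) (hj : 1 ≤ j ∧ j < n) :
    Commute (E n i) (E n j) := by
  have := proj_rel (Rel.commE i j hi hj)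
  simpa [E, commute_iff_eq] using this

theorem commute_T_E {i j : ℕ} (hi : 1 ≤ i ∧ i < n) (hj : 1 ≤ j ∧ j < n)
    (h : i + 1 < j ∨ j + 1 < i) : Commute (T n i) (E n j) := by
  have := proj_rel (Rel.commET' j i hj hi (by rw [lt_abs]; omega))
  have h : Commute (E n j) (T n i) := by
    simpa [E, T, commute_iff_eq] using this
  exact h.symm

theorem commute_T_E_self {i : ℕ} (hi : 1 ≤ i ∧ i < n) : Commute (T n i) (E n i) :=
  (E_mul_T hi).symm

theorem E_mul_E_mul_T {i j : ℕ} (hi : 1 ≤ i ∧ i < n) (hj : 1 ≤ j ∧ j < n)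
    (h : j = i + 1 ∨ i = j + 1) : E n i * E n j * T n i = T n i * E n i * E n j := by
  have := proj_rel (Rel.eet i j hi hj (by rcases h with rfl | rfl <;> simp))
  simpa [E, T] using this

theorem E_mul_T_mul_T {i j : ℕ} (hi : 1 ≤ i ∧ i < n) (hj : 1 ≤ j ∧ j < n)
    (h : j = i + 1 ∨ i = j + 1) : E n i * T n j * T n i = T n j * T n i * E n j := by
  have := proj_rel (Rel.ett i j hi hj (by rcases h with rfl | rfl <;> simp))
  simpa [E, T] using this

theorem braid_B (h : 1 < n) :
    B₁ n * T n 1 * B₁ n * T n 1 = T n 1 * B₁ n * T n 1 * B₁ n := by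
  simpa [B₁, T] using proj_rel (Rel.braidB h)

theorem commute_B_T {i : ℕ} (hi : 1 < i ∧ i < n) : Commute (B₁ n) (T n i) := by
  have := proj_rel (Rel.commBT i hi)
  simpa [B₁, T, commute_iff_eq] using this

theorem B_sq : B₁ n * B₁ n = 1 + (v - v⁻¹) • (F n 1 * B₁ n) := by
  simpa [B₁, F] using proj_rel (Rel.quadB (n := n))

theorem commute_B_E {i : ℕ} (hi : 1 ≤ i ∧ i < n) : Commute (B₁ n) (E n i) := by
  have := proj_rel (Rel.commBE i hi)
  simpa [B₁, E, commute_iff_eq] using this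

theorem F_mul_self {i : ℕ} (hi : 1 ≤ i ∧ i ≤ n) : F n i * F n i = F n i := by
  simpa [F] using proj_rel (Rel.idemF i hi)

theorem commute_B_F {i : ℕ} (hi : 1 ≤ i ∧ i ≤ n) : Commute (B₁ n) (F n i) := by
  have := proj_rel (Rel.commBF i hi)
  simpa [B₁, F, commute_iff_eq] using this

theorem commute_F_E {i j : ℕ} (hi : 1 ≤ i ∧ i ≤ n) (hj : 1 ≤ j ∧ j < n) :
    Commute (F n i) (E n j) := by
  have := proj_rel (Rel.commFE i j hi hj)
  simpa [F, E, commute_iff_eq] using this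

theorem swap_mem_Icc {i j : ℕ} (hi : 1 ≤ i ∧ i < n) (hj : 1 ≤ j ∧ j ≤ n) :
    1 ≤ Equiv.swap i (i + 1) j ∧ Equiv.swap i (i + 1) j ≤ n := by
  rw [Equiv.swap_apply_def]
  split_ifs <;> omega

theorem semiconjBy_T_F {i j : ℕ} (hi : 1 ≤ i ∧ i < n) (hj : 1 ≤ j ∧ j ≤ n) :
    SemiconjBy (T n i) (F n j) (F n (Equiv.swap i (i + 1) j)) := by
  have := proj_rel (Rel.permF i _ hi (swap_mem_Icc hi hj))
  rw [Equiv.swap_apply_self] at this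
  have h : F n (Equiv.swap i (i + 1) j) * T n i = T n i * F n j := by simpa [F, T] using this
  exact h.symm

theorem E_mul_F {i : ℕ} (hi : 1 ≤ i ∧ i < n) : E n i * F n i = F n i * F n (i + 1) := by
  simpa [E, F] using proj_rel (Rel.efLeft i hi)

theorem F_mul_F_succ {i : ℕ} (hi : 1 ≤ i ∧ i < n) :
    F n i * F n (i + 1) = E n i * F n (i + 1) := by
  simpa [E, F] using proj_rel (Rel.efRight i hi)

/-- By the relation `E_mul_E_mul_T`, the term E_iT_i of T_i² commutes with E_j. Consequently T_i and
T_i⁻¹ conjugate E_j to the same element. -/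
theorem commute_T_sq_E {i j : ℕ} (hi : 1 ≤ i ∧ i < n) (hj : 1 ≤ j ∧ j < n)
    (h : j = i + 1 ∨ i = j + 1) : Commute (T n i * T n i) (E n j) := by
  rw [T_sq hi]
  refine (Commute.one_left _).add_left (Commute.smul_left ?_ _)
  have h1 := E_mul_E_mul_T hi hj h
  have h2 := (commute_E_E hi hj).eq
  change E n i * T n i * E n j = E n j * (E n i * T n i)
  rw [E_mul_T hi, ← h1, h2, mul_assoc, E_mul_T hi]

end Relations

/-! ### Conjugation of the E_{i,j} by the T_k -/

section Conjugation

variable {n : ℕ}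

theorem commute_T_Eaux_of_lt {d i k : ℕ} (hk : 1 ≤ k) (hki : k + 1 < i) (hd : i + d < n) :
    Commute (T n k) (Eaux n d i) := by
  induction d generalizing i with
  | zero => exact commute_T_E ⟨hk, by omega⟩ ⟨by omega, by omega⟩ (Or.inl hki)
  | succ d ih =>
    have h : Commute (T n k) (T n i) := commute_T_T ⟨hk, by omega⟩ ⟨by omega, by omega⟩ (Or.inl hki)
    exact (h.mul_right (ih (by omega) (by omega))).mul_right (semiconjBy_Tu_inv_right h)

theorem commute_T_Eaux_of_gt {d i k : ℕ} (hi : 1 ≤ i) (hik : i + d + 1 < k) (hk : k < n) :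
    Commute (T n k) (Eaux n d i) := by
  induction d generalizing i with
  | zero => exact commute_T_E ⟨by omega, by omega⟩ ⟨by omega, by omega⟩ (Or.inr (by omega))
  | succ d ih =>
    have h : Commute (T n k) (T n i) :=
      commute_T_T ⟨by omega, by omega⟩ ⟨by omega, by omega⟩ (Or.inr (by omega))
    exact (h.mul_right (ih (by omega) (by omega))).mul_right (semiconjBy_Tu_inv_right h)

/-- `Eaux` is built by moving the first index; this rebuilds it by moving the last. For d = 0,
`E_mul_T_mul_T` gives T_{i+1}E_iT_{i+1}⁻¹ = T_i⁻¹E_{i+1}T_i, and T_i² commutes with E_{i+1}. For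
larger d, T_{i+d+1} commutes with the outer conjugator T_i. -/
theorem semiconjBy_T_Eaux_last_succ {d i : ℕ} (hi : 1 ≤ i) (hd : i + d + 1 < n) :
    SemiconjBy (T n (i + d + 1)) (Eaux n d i) (Eaux n (d + 1) i) := by
  induction d generalizing i with
  | zero =>
    have h1 := E_mul_T_mul_T (n := n) (i := i + 1) (j := i) ⟨by omega, by omega⟩
      ⟨by omega, by omega⟩ (Or.inr rfl)
    have h2 : Commute (T n i * T n i) (E n (i + 1)) :=
      commute_T_sq_E ⟨by omega, by omega⟩ ⟨by omega, by omega⟩ (Or.inl rfl)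
    refine (isUnit_T n i).mul_left_cancel ?_
    calc T n i * (T n (i + 1) * E n i)
        = E n (i + 1) * T n i * T n (i + 1) := by rw [h1, mul_assoc]
      _ = E n (i + 1) * (T n i * T n i) * ((Tu n i)⁻¹ : (Alg n)ˣ) * T n (i + 1) := by
          rw [mul_assoc (E n (i + 1)) (T n i * T n i), mul_assoc (T n i) (T n i), T_mul_Tu_inv, mul_one]
      _ = T n i * (T n i * E n (i + 1) * ((Tu n i)⁻¹ : (Alg n)ˣ) * T n (i + 1)) := by
          rw [← h2.eq]; simp only [mul_assoc]
  | succ d ih =>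
    have h : Commute (T n (i + (d + 1) + 1)) (T n i) :=
      commute_T_T ⟨by omega, by omega⟩ ⟨by omega, by omega⟩ (Or.inr (by omega))
    have h' := ih (i := i + 1) (by omega) (by omega)
    rw [show i + 1 + d + 1 = i + (d + 1) + 1 by omega] at h'
    exact (SemiconjBy.mul_right h h').mul_right (semiconjBy_Tu_inv_right h)

theorem semiconjBy_T_Eaux_last_pred {d i : ℕ} (hi : 1 ≤ i) (hd : i + d + 1 < n) :
    SemiconjBy (T n (i + d + 1)) (Eaux n (d + 1) i) (Eaux n d i) := by
  induction d generalizing i with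
  | zero =>
    have h1 := E_mul_T_mul_T (n := n) (i := i) (j := i + 1) ⟨by omega, by omega⟩
      ⟨by omega, by omega⟩ (Or.inl rfl)
    change T n (i + 1) * (T n i * E n (i + 1) * ((Tu n i)⁻¹ : (Alg n)ˣ)) = E n i * T n (i + 1)
    rw [← mul_assoc, ← mul_assoc, ← h1, mul_assoc _ (T n i), T_mul_Tu_inv, mul_one]
  | succ d ih =>
    have h : Commute (T n (i + (d + 1) + 1)) (T n i) :=
      commute_T_T ⟨by omega, by omega⟩ ⟨by omega, by omega⟩ (Or.inr (by omega))
    have h' := ih (i := i + 1) (by omega) (by omega)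
    rw [show i + 1 + d + 1 = i + (d + 1) + 1 by omega] at h'
    exact (SemiconjBy.mul_right h h').mul_right (semiconjBy_Tu_inv_right h)

/-- The element T_{i+d+2} that lengthens the idempotent at its right end commutes with T_i, so the
case of a single E_{i+1} propagates. -/
theorem commute_T_sq_Eaux {d i : ℕ} (hi : 1 ≤ i) (hd : i + 1 + d < n) :
    Commute (T n i * T n i) (Eaux n d (i + 1)) := by
  induction d with
  | zero => exact commute_T_sq_E ⟨by omega, by omega⟩ ⟨by omega, by omega⟩ (Or.inl rfl)
  | succ d ih =>
    have h : Commute (T n i) (T n (i + 1 + d + 1)) :=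
      commute_T_T ⟨by omega, by omega⟩ ⟨by omega, by omega⟩ (Or.inl (by omega))
    have h1 := semiconjBy_T_Eaux_last_succ (n := n) (d := d) (i := i + 1) (by omega) (by omega)
    have h2 := SemiconjBy.mul_left (SemiconjBy.mul_left h1 (ih (by omega)))
      (semiconjBy_Tu_inv_left h1)
    have h3 : T n (i + 1 + d + 1) * (T n i * T n i) *
        ((Tu n (i + 1 + d + 1))⁻¹ : (Alg n)ˣ) = T n i * T n i := by
      rw [← (h.mul_left h).eq, mul_assoc, T_mul_Tu_inv, mul_one]
    rwa [h3] at h2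

theorem semiconjBy_T_Eaux_first_pred {d i : ℕ} :
    SemiconjBy (T n i) (Eaux n d (i + 1)) (Eaux n (d + 1) i) := by
  change _ = T n i * _ * _ * _
  rw [mul_assoc _ _ (T n i), Tu_inv_mul_T, mul_one]

theorem semiconjBy_T_Eaux_first_succ {d i : ℕ} (hi : 1 ≤ i) (hd : i + 1 + d < n) :
    SemiconjBy (T n i) (Eaux n (d + 1) i) (Eaux n d (i + 1)) := by
  have h := (commute_T_sq_Eaux (n := n) hi hd).eq
  change T n i * (T n i * _ * _) = _
  rw [← mul_assoc, ← mul_assoc, h, mul_assoc, mul_assoc (T n i), T_mul_Tu_inv, mul_one]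

theorem commute_T_Eaux_of_mem {d i k : ℕ} (hi : 1 ≤ i) (hik : i < k) (hk : k < i + d)
    (hd : i + d < n) : Commute (T n k) (Eaux n d i) := by
  induction d generalizing i with
  | zero => omega
  | succ d ih =>
    rcases Nat.lt_or_ge (i + 1) k with h1 | h1
    · have h : Commute (T n k) (T n i) :=
        commute_T_T ⟨by omega, by omega⟩ ⟨by omega, by omega⟩ (Or.inr (by omega))
      exact (h.mul_right (ih (by omega) h1 (by omega) (by omega))).mul_right
        (semiconjBy_Tu_inv_right h)
    · obtain rfl : k = i + 1 := by omega
      obtain ⟨d, rfl⟩ : ∃ c, d = c + 1 := ⟨d - 1, by omega⟩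
      -- T_iT_{i+1} carries `Eaux n d (i + 2)` to `Eaux n (d + 2) i`, and so does T_iT_{i+1}T_i,
      -- since T_i commutes with the former. By the braid relation their quotient is T_{i+1}, which
      -- therefore commutes with the latter.
      have h1 : SemiconjBy (T n i * T n (i + 1)) (Eaux n d (i + 1 + 1)) (Eaux n (d + 1 + 1) i) :=
        SemiconjBy.mul_left semiconjBy_T_Eaux_first_pred semiconjBy_T_Eaux_first_pred
      have h2 : Commute (T n i) (Eaux n d (i + 1 + 1)) :=
        commute_T_Eaux_of_lt (by omega) (by omega) (by omega)
      have h3 := SemiconjBy.mul_left h1 h2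
      rw [braid_T ⟨hi, by omega⟩] at h3
      have h1' : SemiconjBy (((Tu n (i + 1))⁻¹ : (Alg n)ˣ) * ((Tu n i)⁻¹ : (Alg n)ˣ) : Alg n)
          (Eaux n (d + 1 + 1) i) (Eaux n d (i + 1 + 1)) :=
        SemiconjBy.mul_left (semiconjBy_Tu_inv_left semiconjBy_T_Eaux_first_pred)
          (semiconjBy_Tu_inv_left semiconjBy_T_Eaux_first_pred)
      have h4 := SemiconjBy.mul_left h3 h1'
      have h5 : T n (i + 1) * T n i * T n (i + 1) *
          (((Tu n (i + 1))⁻¹ : (Alg n)ˣ) * ((Tu n i)⁻¹ : (Alg n)ˣ) : Alg n) = T n (i + 1) := by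
        rw [← mul_assoc, mul_assoc _ (T n (i + 1)), T_mul_Tu_inv, mul_one, mul_assoc, T_mul_Tu_inv,
          mul_one]
      rwa [h5] at h4

end Conjugation

/-- The idempotents attached to the pairs in `{0, …, n}`: `F_j` for `{0, j}`, `E_{i,j}` for
`1 ≤ i < j`, and `1` for a pair of equal indices. -/
noncomputable def ee (n a b : ℕ) : Alg n :=
  if a = b then 1
  else if min a b = 0 then F n (max a b) else Eij n (min a b) (max a b)

/-! ### The transposition action on the pair idempotents -/

section PairIdempotents

variable {n : ℕ}

theorem ee_self (a : ℕ) : ee n a a = 1 := by simp [ee]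

theorem ee_comm (a b : ℕ) : ee n a b = ee n b a := by
  simp [ee, eq_comm, min_comm, max_comm]

theorem ee_zero_left {j : ℕ} (hj : 1 ≤ j) : ee n 0 j = F n j := by
  simp [ee, show 0 ≠ j by omega]

theorem ee_of_lt {i j : ℕ} (hi : 1 ≤ i) (hj : i < j) : ee n i j = Eij n i j := by
  simp [ee, show i ≠ j by omega, min_eq_left hj.le, max_eq_right hj.le, show i ≠ 0 by omega]

theorem ee_Eaux {i d : ℕ} (hi : 1 ≤ i) : ee n i (i + d + 1) = Eaux n d i := by
  rw [ee_of_lt hi (by omega), Eij, show i + d + 1 - i - 1 = d by omega]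

theorem ee_succ {i : ℕ} (hi : 1 ≤ i) : ee n i (i + 1) = E n i := ee_Eaux (d := 0) hi

/-- The cases follow the position of k relative to a < b, each being one of the conjugation lemmas;
for a = 0 it is the relation between T_k and the F_j. -/
theorem semiconjBy_T_ee {k a b : ℕ} (hk : 1 ≤ k ∧ k < n) (ha : a ≤ n) (hb : b ≤ n) :
    SemiconjBy (T n k) (ee n a b)
      (ee n (Equiv.swap k (k + 1) a) (Equiv.swap k (k + 1) b)) := by
  wlog hab : a ≤ b generalizing a b
  · rw [ee_comm a, ee_comm (Equiv.swap k (k + 1) a)]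
    exact this hb ha (by omega)
  rcases hab.eq_or_lt with rfl | hab
  · rw [ee_self, ee_self]
    exact SemiconjBy.one_right _
  rcases Nat.eq_zero_or_pos a with rfl | ha0
  · rw [Equiv.swap_apply_of_ne_of_ne (x := 0) (by omega) (by omega), ee_zero_left hab,
      ee_zero_left (swap_mem_Icc hk ⟨hab, hb⟩).1]
    exact semiconjBy_T_F hk ⟨hab, hb⟩
  obtain ⟨d, rfl⟩ : ∃ d, b = a + d + 1 := ⟨b - a - 1, by omega⟩
  rcases Nat.lt_or_ge (k + 1) a with h1 | h1
  · rw [Equiv.swap_apply_of_ne_of_ne (by omega) (by omega),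
      Equiv.swap_apply_of_ne_of_ne (by omega) (by omega), ee_Eaux ha0]
    exact commute_T_Eaux_of_lt hk.1 h1 (by omega)
  rcases h1.eq_or_lt with rfl | h1
  · rw [Equiv.swap_apply_right, Equiv.swap_apply_of_ne_of_ne (by omega) (by omega), ee_Eaux ha0,
      show k + 1 + d + 1 = k + (d + 1) + 1 by omega, ee_Eaux hk.1]
    exact semiconjBy_T_Eaux_first_pred
  rcases (Nat.lt_succ_iff.1 h1).eq_or_lt with rfl | h1
  · rcases Nat.eq_zero_or_pos d with rfl | hd
    · rw [Nat.add_zero, Equiv.swap_apply_left, Equiv.swap_apply_right, ee_comm (a + 1), ee_succ ha0]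
      exact commute_T_E_self hk
    · obtain ⟨d, rfl⟩ : ∃ c, d = c + 1 := ⟨d - 1, by omega⟩
      rw [Equiv.swap_apply_left, Equiv.swap_apply_of_ne_of_ne (by omega) (by omega), ee_Eaux ha0,
        show a + (d + 1) + 1 = a + 1 + d + 1 by omega, ee_Eaux (by omega)]
      exact semiconjBy_T_Eaux_first_succ ha0 (by omega)
  rcases Nat.lt_or_ge k (a + d) with h2 | h2
  · rw [Equiv.swap_apply_of_ne_of_ne (by omega) (by omega),
      Equiv.swap_apply_of_ne_of_ne (by omega) (by omega), ee_Eaux ha0]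
    exact commute_T_Eaux_of_mem ha0 h1 h2 (by omega)
  rcases h2.eq_or_lt with rfl | h2
  · obtain ⟨d, rfl⟩ : ∃ c, d = c + 1 := ⟨d - 1, by omega⟩
    rw [Equiv.swap_apply_of_ne_of_ne (by omega) (by omega), Equiv.swap_apply_right, ee_Eaux ha0,
      ← add_assoc, ee_Eaux ha0]
    exact semiconjBy_T_Eaux_last_pred ha0 (by omega)
  rcases (Nat.succ_le_of_lt h2).eq_or_lt with h2 | h2
  · obtain rfl : k = a + d + 1 := by omega
    rw [Equiv.swap_apply_of_ne_of_ne (by omega) (by omega), Equiv.swap_apply_left, ee_Eaux ha0,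
      show a + d + 1 + 1 = a + (d + 1) + 1 by omega, ee_Eaux ha0]
    exact semiconjBy_T_Eaux_last_succ ha0 (by omega)
  · rw [Equiv.swap_apply_of_ne_of_ne (by omega) (by omega),
      Equiv.swap_apply_of_ne_of_ne (by omega) (by omega), ee_Eaux ha0]
    exact commute_T_Eaux_of_gt ha0 (by omega) hk.2

end PairIdempotents

/-- A permutation of the indices is realized if it preserves `{0, …, n}`, fixes `0`, and is induced
on the idempotents `ee n a b` by conjugation with a unit. -/
def Realized (n : ℕ) (σ : Equiv.Perm ℕ) : Prop :=
  (∀ a ≤ n, σ a ≤ n) ∧ σ 0 = 0 ∧ ∃ g : (Alg n)ˣ, ∀ a ≤ n, ∀ b ≤ n,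
    SemiconjBy (g : Alg n) (ee n a b) (ee n (σ a) (σ b))

/-! ### Relations among pair idempotents by transport to small indices -/

section Realized

variable {n : ℕ}

theorem Realized.one : Realized n 1 :=
  ⟨fun _ h => h, rfl, 1, fun _ _ _ _ => SemiconjBy.one_left _⟩

theorem Realized.mul {σ τ : Equiv.Perm ℕ} (hσ : Realized n σ) (hτ : Realized n τ) :
    Realized n (σ * τ) := by
  obtain ⟨h1, h2, g, hg⟩ := hσ
  obtain ⟨h3, h4, k, hk⟩ := hτ
  refine ⟨fun a ha => h1 _ (h3 _ ha), by simp [h2, h4], g * k, fun a ha b hb => ?_⟩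
  rw [Units.val_mul]
  exact (hg _ (h3 a ha) _ (h3 b hb)).mul_left (hk a ha b hb)

theorem Realized.swap_succ {i : ℕ} (hi : 1 ≤ i ∧ i < n) :
    Realized n (Equiv.swap i (i + 1)) := by
  refine ⟨fun a ha => ?_, Equiv.swap_apply_of_ne_of_ne (by omega) (by omega), Tu n i,
    fun a ha b hb => ?_⟩
  · rw [Equiv.swap_apply_def]
    split_ifs <;> omega
  · rw [Tu_val]
    exact semiconjBy_T_ee hi ha hb

theorem Realized.swap {i j : ℕ} (hi : 1 ≤ i) (hij : i ≤ j) (hj : j ≤ n) :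
    Realized n (Equiv.swap i j) := by
  induction j, hij using Nat.le_induction with
  | base => rw [Equiv.swap_self]; exact Realized.one
  | succ j hij ih =>
    have h1 : Realized n (Equiv.swap j (j + 1)) := Realized.swap_succ ⟨by omega, by omega⟩
    rcases hij.eq_or_lt with rfl | hij
    · exact h1
    have h2 := (h1.mul (ih (by omega))).mul h1
    rwa [Equiv.swap_mul_swap_mul_swap (by omega)
      (by omega), Equiv.swap_comm] at h2

/-- Identities among pair idempotents can thus be moved to the indices 1, 2, 3, …, where the
defining relations apply. As 0 is fixed, the F_j can take part. -/
theorem exists_realized (l : List ℕ) (hl : l.Nodup) (hn : ∀ a ∈ l, 1 ≤ a ∧ a ≤ n) :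
    ∃ σ, Realized n σ ∧ l.map σ = List.range' 1 l.length := by
  induction l using List.reverseRecOn with
  | nil => exact ⟨1, Realized.one, rfl⟩
  | append_singleton l c ih =>
    rw [List.nodup_append] at hl
    obtain ⟨σ, hσ, h⟩ := ih hl.1 (fun a ha => hn a (by simp [ha]))
    have hc := hn c (by simp)
    have hmem : ∀ x, x ∈ List.range' 1 l.length → σ c ≠ x := by
      rintro x hx rfl
      rw [← h, List.mem_map_of_injective σ.injective] at hx
      exact hl.2.2 c hx c (by simp) rfl
    have h0 : σ c ≠ 0 := fun h0 => by
      rw [← hσ.2.1] at h0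
      have := σ.injective h0
      omega
    have h1 : l.length + 1 ≤ σ c := by
      by_contra hlt
      exact hmem (σ c) (List.mem_range'_1.2 (by omega)) rfl
    -- The values 1,…,|l| are already taken by l and σ c exceeds them, so this swap places c without
    -- disturbing l.
    refine ⟨Equiv.swap (l.length + 1) (σ c) * σ,
      (Realized.swap (by omega) h1 (hσ.1 c hc.2)).mul hσ, ?_⟩
    rw [List.map_append, List.length_append, List.length_singleton, List.range'_concat, ← h]
    congr 1
    · refine List.map_congr_left fun a ha => ?_
      have ha' : σ a ∈ List.range' 1 l.length := h ▸ List.mem_map_of_mem ha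
      have := List.mem_range'_1.1 ha'
      exact Equiv.swap_apply_of_ne_of_ne (by omega) (hmem _ ha').symm
    · simp [add_comm]

theorem eq_of_semiconjBy {g : (Alg n)ˣ} {x y x' y' : Alg n} (hx : SemiconjBy (g : Alg n) x x')
    (hy : SemiconjBy (g : Alg n) y y') (h : x' = y') : x = y := by
  refine g.isUnit.mul_left_cancel ?_
  rw [hx.eq, hy.eq, h]

theorem Realized.ee_mul_ee {σ : Equiv.Perm ℕ} (hσ : Realized n σ) {a b c d a' b' c' d' : ℕ}
    (ha : a ≤ n) (hb : b ≤ n) (hc : c ≤ n) (hd : d ≤ n)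
    (ha' : a' ≤ n) (hb' : b' ≤ n) (hc' : c' ≤ n) (hd' : d' ≤ n)
    (h : ee n (σ a) (σ b) * ee n (σ c) (σ d) = ee n (σ a') (σ b') * ee n (σ c') (σ d')) :
    ee n a b * ee n c d = ee n a' b' * ee n c' d' := by
  obtain ⟨-, -, g, hg⟩ := hσ
  exact eq_of_semiconjBy ((hg a ha b hb).mul_right (hg c hc d hd))
    ((hg a' ha' b' hb').mul_right (hg c' hc' d' hd')) h

theorem ee_mul_self {a b : ℕ} (ha : a ≤ n) (hb : b ≤ n) : ee n a b * ee n a b = ee n a b := by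
  wlog hab : a ≤ b generalizing a b
  · rw [ee_comm a]; exact this hb ha (by omega)
  rcases hab.eq_or_lt with rfl | hab
  · rw [ee_self, mul_one]
  rcases Nat.eq_zero_or_pos a with rfl | ha0
  · rw [ee_zero_left hab]; exact F_mul_self ⟨hab, hb⟩
  obtain ⟨σ, hσ, h⟩ := exists_realized (n := n) [a, b] (by simp; omega) (by simp; omega)
  simp [List.range'] at h
  -- The trivial factor `ee n a a = 1` brings idempotence into the form of an equality of two
  -- products of two factors.
  have := hσ.ee_mul_ee ha hb ha hb ha hb ha ha (by
    rw [h.1, h.2, ee_self, ee_succ le_rfl, E_mul_self ⟨le_rfl, by omega⟩, mul_one])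
  rwa [ee_self, mul_one] at this

/-- Commutativity of the F_j is not a defining relation. Conjugating E_iF_i = F_iF_{i+1} by T_i
gives E_iF_{i+1} = F_{i+1}F_i, and E_iF_{i+1} is also F_iF_{i+1}. -/
theorem F_mul_F_comm {i : ℕ} (hi : 1 ≤ i ∧ i < n) : Commute (F n i) (F n (i + 1)) := by
  have h1 := semiconjBy_T_F (n := n) hi (j := i) ⟨by omega, by omega⟩
  have h2 := semiconjBy_T_F (n := n) hi (j := i + 1) ⟨by omega, by omega⟩
  rw [Equiv.swap_apply_left] at h1
  rw [Equiv.swap_apply_right] at h2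
  have h3 := h1.mul_right h2
  have h4 := SemiconjBy.mul_right (commute_T_E_self hi) h1
  rw [E_mul_F hi] at h4
  refine (isUnit_T n i).mul_right_cancel ?_
  rw [F_mul_F_succ hi, ← h4.eq, ← h3.eq]

theorem commute_E_one_ee (hn : 1 < n) {c d : ℕ} (hcd : c < d) (hd : d ≤ n) :
    Commute (ee n 1 2) (ee n c d) := by
  rcases Nat.eq_zero_or_pos c with rfl | hc0
  · rw [ee_zero_left hcd, ee_succ le_rfl]
    exact (commute_F_E ⟨hcd, hd⟩ ⟨le_rfl, hn⟩).symm
  rcases Nat.lt_or_ge 2 c with hc | hc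
  · obtain ⟨σ, hσ, h⟩ := exists_realized (n := n) [1, 2, c, d] (by simp; omega) (by simp; omega)
    simp [List.range'] at h
    obtain ⟨h1, h2, h3, h4⟩ := h
    refine hσ.ee_mul_ee (by omega) (by omega) (by omega) (by omega) (by omega) (by omega)
      (by omega) (by omega) ?_
    rw [h1, h2, h3, h4, ee_succ le_rfl, ee_succ (by norm_num)]
    exact commute_E_E ⟨le_rfl, hn⟩ ⟨by norm_num, by omega⟩
  rcases hc.eq_or_lt with rfl | hc
  · obtain ⟨σ, hσ, h⟩ := exists_realized (n := n) [1, 2, d] (by simp; omega) (by simp; omega)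
    simp [List.range'] at h
    obtain ⟨h1, h2, h3⟩ := h
    refine hσ.ee_mul_ee (by omega) (by omega) (by omega) (by omega) (by omega) (by omega)
      (by omega) (by omega) ?_
    rw [h1, h2, h3, ee_succ le_rfl, ee_succ (by norm_num)]
    exact commute_E_E ⟨le_rfl, hn⟩ ⟨by norm_num, by omega⟩
  obtain rfl : c = 1 := by omega
  rcases (Nat.succ_le_of_lt hcd).eq_or_lt with rfl | hd2
  · exact Commute.refl _
  -- Listing 2 first sends the shared index 1 to 2, so that the two pairs become those of E_1 and
  -- E_2.
  obtain ⟨σ, hσ, h⟩ := exists_realized (n := n) [2, 1, d] (by simp; omega) (by simp; omega)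
  simp [List.range'] at h
  obtain ⟨h1, h2, h3⟩ := h
  refine hσ.ee_mul_ee (by omega) (by omega) (by omega) (by omega) (by omega) (by omega)
    (by omega) (by omega) ?_
  rw [h1, h2, h3, ee_comm 2 1, ee_succ le_rfl, ee_succ (by norm_num)]
  exact commute_E_E ⟨le_rfl, hn⟩ ⟨by norm_num, by omega⟩

theorem commute_ee_of_pos {a b c d : ℕ} (ha : 1 ≤ a) (hab : a < b) (hb : b ≤ n)
    (hcd : c < d) (hd : d ≤ n) : Commute (ee n a b) (ee n c d) := by
  obtain ⟨σ, hσ, h⟩ := exists_realized (n := n) [a, b] (by simp; omega) (by simp; omega)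
  simp [List.range'] at h
  obtain ⟨h1, h2⟩ := h
  refine hσ.ee_mul_ee (by omega) (by omega) (by omega) (by omega) (by omega) (by omega)
    (by omega) (by omega) ?_
  rw [h1, h2]
  have hne : σ c ≠ σ d := fun h => hcd.ne (σ.injective h)
  rcases Nat.lt_or_ge (σ c) (σ d) with h | h
  · exact commute_E_one_ee (by omega) h (hσ.1 _ hd)
  · rw [ee_comm (σ c)]
    exact commute_E_one_ee (by omega) (by omega) (hσ.1 _ (by omega))

theorem commute_ee {a b c d : ℕ} (ha : a ≤ n) (hb : b ≤ n) (hc : c ≤ n) (hd : d ≤ n) :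
    Commute (ee n a b) (ee n c d) := by
  wlog hab : a ≤ b generalizing a b
  · rw [ee_comm a]; exact this hb ha (by omega)
  wlog hcd : c ≤ d generalizing c d
  · rw [ee_comm c]; exact this hd hc (by omega)
  rcases hab.eq_or_lt with rfl | hab
  · rw [ee_self]; exact Commute.one_left _
  rcases hcd.eq_or_lt with rfl | hcd
  · rw [ee_self]; exact Commute.one_right _
  rcases Nat.eq_zero_or_pos a with rfl | ha0
  · rcases Nat.eq_zero_or_pos c with rfl | hc0
    · rcases eq_or_ne b d with rfl | hbd
      · exact Commute.refl _
      obtain ⟨σ, hσ, h⟩ := exists_realized (n := n) [b, d] (by simp; omega) (by simp; omega)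
      simp [List.range'] at h
      obtain ⟨h1, h2⟩ := h
      refine hσ.ee_mul_ee (by omega) (by omega) (by omega) (by omega) (by omega) (by omega)
        (by omega) (by omega) ?_
      rw [h1, h2, hσ.2.1, ee_zero_left (by norm_num), ee_zero_left (by norm_num)]
      exact F_mul_F_comm ⟨le_rfl, by omega⟩
    · exact (commute_ee_of_pos hc0 hcd hd hab hb).symm
  · exact commute_ee_of_pos ha0 hab hb hcd hd

/-- For distinct positive indices the claim transports to E_1E_2 = E_1E_{1,3}: conjugation by T_1
turns the left side into the right, but T_1 also commutes with E_1E_2. If exactly one of three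
distinct indices is 0, it follows from E_iF_i = F_iF_{i+1}. -/
theorem ee_mul_ee_eq {a b c : ℕ} (ha : a ≤ n) (hb : b ≤ n) (hc : c ≤ n) :
    ee n a b * ee n b c = ee n a b * ee n a c := by
  rcases eq_or_ne a b with rfl | hab
  · rfl
  rcases eq_or_ne b c with rfl | hbc
  · rw [ee_self, mul_one, ee_mul_self ha hb]
  rcases eq_or_ne a c with rfl | hac
  · rw [ee_self, mul_one, ee_comm b a, ee_mul_self ha hb]
  have key {x y : ℕ} (hx : 1 ≤ x) (hy : 1 ≤ y) (hxy : x ≠ y) (hx' : x ≤ n) (hy' : y ≤ n) :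
      ee n x y * ee n 0 x = ee n 0 x * ee n 0 y := by
    obtain ⟨σ, hσ, h⟩ := exists_realized (n := n) [x, y] (by simp; omega) (by simp; omega)
    simp [List.range'] at h
    obtain ⟨h1, h2⟩ := h
    refine hσ.ee_mul_ee (by omega) (by omega) (by omega) (by omega) (by omega) (by omega)
      (by omega) (by omega) ?_
    rw [h1, h2, hσ.2.1, ee_zero_left (by norm_num), ee_zero_left (by norm_num), ee_succ le_rfl]
    exact E_mul_F ⟨le_rfl, by omega⟩
  rcases Nat.eq_zero_or_pos a with rfl | ha0
  · rw [(commute_ee ha hb hb hc).eq, key (by omega) (by omega) hbc hb hc]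
  rcases Nat.eq_zero_or_pos b with rfl | hb0
  · rw [ee_comm a 0, ← key ha0 (by omega) hac ha hc, (commute_ee ha hc hb ha).eq]
  rcases Nat.eq_zero_or_pos c with rfl | hc0
  · rw [ee_comm b 0, ee_comm a 0, key ha0 hb0 hab ha hb, ee_comm a b,
      key hb0 ha0 hab.symm hb ha, (commute_ee hc ha hc hb).eq]
  obtain ⟨σ, hσ, h⟩ := exists_realized (n := n) [a, b, c] (by simp; omega) (by simp; omega)
  simp [List.range'] at h
  obtain ⟨h1, h2, h3⟩ := h
  refine hσ.ee_mul_ee (by omega) (by omega) (by omega) (by omega) (by omega) (by omega)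
    (by omega) (by omega) ?_
  have hT1 : 1 ≤ 1 ∧ 1 < n := ⟨le_rfl, by omega⟩
  have hT2 : 1 ≤ 2 ∧ 2 < n := ⟨by norm_num, by omega⟩
  rw [h1, h2, h3]
  have hc1 := (semiconjBy_T_ee hT1 (a := 1) (b := 2) (by omega) (by omega)).mul_right
    (semiconjBy_T_ee hT1 (a := 2) (b := 3) (by omega) (by omega))
  have e1 : Equiv.swap 1 (1 + 1) 1 = 2 := by decide
  have e2 : Equiv.swap 1 (1 + 1) 2 = 1 := by decide
  have e3 : Equiv.swap 1 (1 + 1) 3 = 3 := by decide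
  rw [e1, e2, e3, ee_comm 2 1, ee_succ le_rfl, ee_succ (by norm_num)] at hc1
  have h4 := E_mul_E_mul_T hT1 hT2 (Or.inl rfl)
  refine (isUnit_T n 1).mul_right_cancel ?_
  rw [ee_succ le_rfl, ee_succ (by norm_num), ← hc1.eq, h4, mul_assoc]

/-- Together with `ee_self` and `ee_comm`, this makes the pairs whose idempotent fixes x an
equivalence relation; this is how set partitions enter. -/
theorem ee_trans {a b c : ℕ} (ha : a ≤ n) (hb : b ≤ n) (hc : c ≤ n) {x : Alg n}
    (h1 : ee n a b * x = x) (h2 : ee n b c * x = x) : ee n a c * x = x := by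
  have h : ee n a c * (ee n a b * ee n b c) = ee n a b * ee n b c := by
    rw [ee_mul_ee_eq ha hb hc, ← mul_assoc, (commute_ee ha hc ha hb).eq, mul_assoc,
      ee_mul_self ha hc]
  calc ee n a c * x = ee n a c * (ee n a b * ee n b c) * x := by
        rw [mul_assoc, mul_assoc, h2, h1]
    _ = x := by rw [h, mul_assoc, h2, h1]

end Realized

/-! ### The commutative monoid of the idempotents EF_I -/

section PartitionIdempotents

variable {n : ℕ}

theorem mul_list_prod_of_mem {R : Type*} [Monoid R] {x y : R} {L : List R}
    (hx : ∀ z ∈ L, Commute x z) (hy : y ∈ L) (hxy : x * y = y) : x * L.prod = L.prod := by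
  induction L with
  | nil => simp at hy
  | cons z L ih =>
    rw [List.prod_cons]
    rcases List.mem_cons.1 hy with rfl | hy
    · rw [← mul_assoc, hxy]
    · rw [← mul_assoc, (hx z (by simp)).eq, mul_assoc,
        ih (fun w hw => hx w (by simp [hw])) hy]

/-- The submonoid generated by the `ee n a b` with `a`, `b` in the same block of `I`. -/
noncomputable def blockMonoid (I : P₀ n) : Submonoid (Alg n) :=
  Submonoid.closure {x | ∃ a b, a ≤ n ∧ b ≤ n ∧ b ∈ I.part a ∧ x = ee n a b}

/-- The submonoid generated by all the `ee n a b`. -/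
noncomputable def pairMonoid (n : ℕ) : Submonoid (Alg n) :=
  Submonoid.closure {x | ∃ a b, a ≤ n ∧ b ≤ n ∧ x = ee n a b}

theorem blockMonoid_le (I : P₀ n) : blockMonoid I ≤ pairMonoid n :=
  Submonoid.closure_mono fun _ ⟨a, b, ha, hb, _, h⟩ => ⟨a, b, ha, hb, h⟩

theorem ee_mem_pairMonoid {a b : ℕ} (ha : a ≤ n) (hb : b ≤ n) : ee n a b ∈ pairMonoid n :=
  Submonoid.subset_closure ⟨a, b, ha, hb, rfl⟩

theorem commute_of_mem_pairMonoid {x y : Alg n} (hx : x ∈ pairMonoid n) (hy : y ∈ pairMonoid n) :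
    Commute x y := by
  induction hx, hy using Submonoid.closure_induction₂ with
  | mem x y hx hy =>
    obtain ⟨a, b, ha, hb, rfl⟩ := hx
    obtain ⟨c, d, hc, hd, rfl⟩ := hy
    exact commute_ee ha hb hc hd
  | one_left => exact Commute.one_left _
  | one_right => exact Commute.one_right _
  | mul_left x y z hx hy hz h1 h2 => exact h1.mul_left h2
  | mul_right x y z hx hy hz h1 h2 => exact h1.mul_right h2

theorem mem_blockMonoid {I : P₀ n} {a b : ℕ} (ha : a ≤ n) (hb : b ≤ n) (h : b ∈ I.part a) :
    ee n a b ∈ blockMonoid I :=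
  Submonoid.subset_closure ⟨a, b, ha, hb, h, rfl⟩

theorem le_of_mem_part {I : P₀ n} {a b : ℕ} (h : b ∈ I.part a) : b ≤ n := by
  have := I.part_subset a h
  simpa [Nat.lt_succ_iff] using this

theorem part_eq_of_mem_part {I : P₀ n} {a b : ℕ} (ha : a ≤ n) (h : b ∈ I.part a) :
    I.part b = I.part a :=
  I.part_eq_of_mem (I.part_mem.2 (by simpa [Nat.lt_succ_iff] using ha)) h

theorem mem_part_self {I : P₀ n} {a : ℕ} (ha : a ≤ n) : a ∈ I.part a :=
  I.mem_part (by simpa [Nat.lt_succ_iff] using ha)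

theorem EJ_mem_blockMonoid {I : P₀ n} {i : ℕ} (hi : i ≤ n) (h0 : 0 ∉ I.part i) :
    EJ n (I.part i) ∈ blockMonoid I := by
  refine Submonoid.list_prod_mem _ fun x hx => ?_
  obtain ⟨a, ha, rfl⟩ := List.mem_map.1 hx
  refine Submonoid.list_prod_mem _ fun y hy => ?_
  obtain ⟨b, hb, rfl⟩ := List.mem_map.1 hy
  rw [Finset.mem_sort] at ha hb
  rw [Finset.mem_filter] at hb
  have ha0 : 1 ≤ a := Nat.one_le_iff_ne_zero.2 fun h => h0 (h ▸ ha)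
  rw [← ee_of_lt ha0 hb.2]
  exact mem_blockMonoid (le_of_mem_part ha) (le_of_mem_part hb.1)
    (by rw [part_eq_of_mem_part hi ha]; exact hb.1)

theorem prod_EJ_mem_blockMonoid (I : P₀ n) :
    ∀ x ∈ ((mins I).sort (· ≤ ·)).map fun i => EJ n (I.part i), x ∈ blockMonoid I := by
  intro x hx
  obtain ⟨i, hi, rfl⟩ := List.mem_map.1 hx
  rw [Finset.mem_sort, mins, Finset.mem_filter, Finset.mem_range] at hi
  exact EJ_mem_blockMonoid (by omega) hi.2.1

theorem F_mem_blockMonoid (I : P₀ n) :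
    ∀ x ∈ (((I.part 0).erase 0).sort (· ≤ ·)).map fun i => F n i, x ∈ blockMonoid I := by
  intro x hx
  obtain ⟨i, hi, rfl⟩ := List.mem_map.1 hx
  rw [Finset.mem_sort, Finset.mem_erase] at hi
  rw [← ee_zero_left (by omega)]
  exact mem_blockMonoid (by omega) (le_of_mem_part hi.2) hi.2

theorem EF_mem_blockMonoid (I : P₀ n) : EF I ∈ blockMonoid I :=
  mul_mem (Submonoid.list_prod_mem _ (prod_EJ_mem_blockMonoid I))
    (Submonoid.list_prod_mem _ (F_mem_blockMonoid I))

theorem commute_ee_of_mem {I : P₀ n} {a b : ℕ} (ha : a ≤ n) (hb : b ≤ n) {x : Alg n}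
    (hx : x ∈ blockMonoid I) : Commute (ee n a b) x :=
  commute_of_mem_pairMonoid (ee_mem_pairMonoid ha hb) (blockMonoid_le I hx)

theorem ee_mul_EJ {I : P₀ n} {a b i : ℕ} (hi : i ≤ n) (h0 : 0 ∉ I.part i) (hab : a < b)
    (ha : a ∈ I.part i) (hb : b ∈ I.part i) :
    ee n a b * EJ n (I.part i) = EJ n (I.part i) := by
  have ha0 : 1 ≤ a := Nat.one_le_iff_ne_zero.2 fun h => h0 (h ▸ ha)
  have hmem : ∀ c ∈ I.part i, ∀ y ∈ (((I.part i).filter fun j => c < j).sort (· ≤ ·)).map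
      fun j => Eij n c j, y ∈ blockMonoid I := by
    intro c hc y hy
    obtain ⟨d, hd, rfl⟩ := List.mem_map.1 hy
    rw [Finset.mem_sort, Finset.mem_filter] at hd
    rw [← ee_of_lt (Nat.one_le_iff_ne_zero.2 fun h => h0 (h ▸ hc)) hd.2]
    exact mem_blockMonoid (le_of_mem_part hc) (le_of_mem_part hd.1)
      (by rw [part_eq_of_mem_part hi hc]; exact hd.1)
  refine mul_list_prod_of_mem (y := (((((I.part i).filter fun j => a < j).sort (· ≤ ·)).map
      fun j => Eij n a j)).prod) ?_ ?_ ?_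
  · intro z hz
    obtain ⟨c, hc, rfl⟩ := List.mem_map.1 hz
    rw [Finset.mem_sort] at hc
    exact commute_ee_of_mem (le_of_mem_part ha) (le_of_mem_part hb)
      (Submonoid.list_prod_mem _ (hmem c hc))
  · exact List.mem_map.2 ⟨a, by rwa [Finset.mem_sort], rfl⟩
  · refine mul_list_prod_of_mem (y := ee n a b) (fun z hz => commute_ee_of_mem (le_of_mem_part ha)
      (le_of_mem_part hb) (hmem a ha z hz)) ?_ (ee_mul_self (le_of_mem_part ha) (le_of_mem_part hb))
    refine List.mem_map.2 ⟨b, ?_, (ee_of_lt ha0 hab).symm⟩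
    rw [Finset.mem_sort, Finset.mem_filter]
    exact ⟨hb, hab⟩

theorem exists_mem_mins {I : P₀ n} {a : ℕ} (ha : a ≤ n) (h0 : 0 ∉ I.part a) :
    ∃ i ∈ mins I, I.part i = I.part a := by
  have hne : (I.part a).Nonempty := ⟨a, mem_part_self ha⟩
  have hm := Finset.min'_mem _ hne
  have hp := part_eq_of_mem_part ha hm
  refine ⟨_, ?_, hp⟩
  have hle := le_of_mem_part hm
  rw [mins, Finset.mem_filter, Finset.mem_range, hp]
  exact ⟨by omega, h0, fun j hj => Finset.min'_le _ j hj⟩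

/-- In a block without 0 the idempotent is a factor of `EJ` and is absorbed. In the block of 0 only
the pairs (0,c) occur as factors, and (a,b) is reached through 0 by `ee_trans`. -/
theorem ee_mul_EF {I : P₀ n} {a b : ℕ} (ha : a ≤ n) (h : b ∈ I.part a) :
    ee n a b * EF I = EF I := by
  have hb := le_of_mem_part h
  wlog hab : a ≤ b generalizing a b
  · rw [ee_comm]
    exact this hb (by rw [part_eq_of_mem_part ha h]; exact mem_part_self ha) ha (by omega)
  rcases hab.eq_or_lt with rfl | hab
  · rw [ee_self, one_mul]
  by_cases h0 : 0 ∈ I.part a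
  · have hp := part_eq_of_mem_part ha h0
    have hF : ∀ c ∈ I.part a, ee n 0 c * FA n ((I.part 0).erase 0) =
        FA n ((I.part 0).erase 0) := by
      intro c hc
      have hcn := le_of_mem_part hc
      rcases Nat.eq_zero_or_pos c with rfl | hc0
      · rw [ee_self, one_mul]
      refine mul_list_prod_of_mem (y := ee n 0 c) (fun z hz => commute_ee_of_mem (by omega) hcn
        (F_mem_blockMonoid I z hz)) ?_ (ee_mul_self (by omega) hcn)
      refine List.mem_map.2 ⟨c, ?_, (ee_zero_left hc0).symm⟩
      rw [Finset.mem_sort, Finset.mem_erase, hp]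
      exact ⟨by omega, hc⟩
    rw [EF, ← mul_assoc, (commute_ee_of_mem ha hb
      (Submonoid.list_prod_mem _ (prod_EJ_mem_blockMonoid I))).eq, mul_assoc]
    congr 1
    refine ee_trans ha (Nat.zero_le n) hb ?_ (hF b h)
    rw [ee_comm]
    exact hF a (mem_part_self ha)
  · obtain ⟨i, hi, hp⟩ := exists_mem_mins ha h0
    have hin : i ≤ n := le_of_mem_part (hp ▸ mem_part_self (by
      rw [mins, Finset.mem_filter, Finset.mem_range] at hi; omega))
    rw [EF, ← mul_assoc]
    congr 1
    refine mul_list_prod_of_mem (y := EJ n (I.part i)) (fun z hz => commute_ee_of_mem ha hb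
      (prod_EJ_mem_blockMonoid I z hz)) (List.mem_map.2 ⟨i, by rwa [Finset.mem_sort], rfl⟩) ?_
    exact ee_mul_EJ hin (hp ▸ h0) hab (hp ▸ mem_part_self ha) (hp ▸ h)

theorem mul_eq_of_mem_blockMonoid {I : P₀ n} {x y : Alg n} (hx : x ∈ blockMonoid I)
    (h : ∀ a b, a ≤ n → b ≤ n → b ∈ I.part a → ee n a b * y = y) : x * y = y := by
  induction hx using Submonoid.closure_induction with
  | mem x hx =>
    obtain ⟨a, b, ha, hb, hab, rfl⟩ := hx
    exact h a b ha hb hab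
  | one => exact one_mul y
  | mul x z _ _ hx hz => rw [mul_assoc, hz, hx]

theorem EF_bot : EF (⊥ : P₀ n) = 1 := by
  have h := mul_eq_of_mem_blockMonoid (y := 1) (EF_mem_blockMonoid (⊥ : P₀ n)) ?_
  · rwa [mul_one] at h
  · intro a b ha hb hab
    obtain ⟨p, hp, h1, h2⟩ := (Finpartition.mem_part_iff_exists _).1 hab
    obtain ⟨c, -, rfl⟩ := Finpartition.mem_bot_iff.1 hp
    rw [Finset.mem_singleton] at h1 h2
    rw [h1, h2, ee_self, one_mul]

open Classical in
/-- The partition obtained from `I` by merging the blocks of `a` and `b`. -/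
noncomputable def merge (I : P₀ n) (a b : ℕ) : P₀ n :=
  Finpartition.ofSetSetoid
    (Setoid.ker fun x => if I.part x = I.part b then I.part a else I.part x) _

theorem mem_part_merge {I : P₀ n} {a b x y : ℕ} (hx : x ≤ n) (hy : y ≤ n) :
    y ∈ (merge I a b).part x ↔ (if I.part x = I.part b then I.part a else I.part x) =
      if I.part y = I.part b then I.part a else I.part y := by
  rw [merge, Finpartition.mem_part_ofSetSetoid_iff_rel, Finset.mem_range, Finset.mem_range,
    Setoid.ker_def]
  constructor
  · rintro ⟨-, -, h⟩
    convert h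
  · intro h
    refine ⟨by omega, by omega, ?_⟩
    convert h

/-- Commuting elements x, y with xy = y and yx = x are equal. Here each side absorbs the other
because the merged relation is generated by I and the pair (a,b). -/
theorem ee_mul_EF_eq_merge {I : P₀ n} {a b : ℕ} (ha : a ≤ n) (hb : b ≤ n) :
    ee n a b * EF I = EF (merge I a b) := by
  have h1 : ee n a b * EF I * EF (merge I a b) = EF (merge I a b) := by
    rw [mul_assoc, mul_eq_of_mem_blockMonoid (EF_mem_blockMonoid I)]
    · refine ee_mul_EF ha ((mem_part_merge ha hb).2 ?_)
      split_ifs <;> simp_all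
    · intro c d hc hd hcd
      refine ee_mul_EF hc ((mem_part_merge hc hd).2 ?_)
      rw [part_eq_of_mem_part hc hcd]
  have hab : ee n a b * (ee n a b * EF I) = ee n a b * EF I := by
    rw [← mul_assoc, ee_mul_self ha hb]
  have hI : ∀ c d, c ≤ n → d ≤ n → I.part c = I.part d →
      ee n c d * (ee n a b * EF I) = ee n a b * EF I := by
    intro c d hc hd hcd
    rw [← mul_assoc, (commute_ee hc hd ha hb).eq, mul_assoc,
      ee_mul_EF hc (by rw [hcd]; exact mem_part_self hd)]
  have h2 : EF (merge I a b) * (ee n a b * EF I) = ee n a b * EF I := by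
    refine mul_eq_of_mem_blockMonoid (EF_mem_blockMonoid _) fun c d hc hd hcd => ?_
    rw [mem_part_merge hc hd] at hcd
    split_ifs at hcd with h3 h4 h4
    · exact hI c d hc hd (h3.trans h4.symm)
    · refine ee_trans hc ha hd (ee_trans hc hb ha (hI c b hc hb h3) ?_) (hI a d ha hd hcd)
      rw [ee_comm]
      exact hab
    · exact ee_trans hc ha hd (hI c a hc ha hcd) (ee_trans ha hb hd hab (hI b d hb hd h4.symm))
    · exact hI c d hc hd hcd
  have h3 := commute_of_mem_pairMonoid (mul_mem (ee_mem_pairMonoid ha hb)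
    (blockMonoid_le _ (EF_mem_blockMonoid I)))
    (blockMonoid_le _ (EF_mem_blockMonoid (merge I a b)))
  rw [← h2, ← h3.eq, h1]

theorem pairMonoid_eq_range : (pairMonoid n : Set (Alg n)) = Set.range (EF (n := n)) := by
  refine Set.Subset.antisymm (fun x hx => ?_) ?_
  · induction hx using Submonoid.closure_induction_left with
    | one => exact ⟨⊥, EF_bot⟩
    | mul_left x hx y _ hy =>
      obtain ⟨a, b, ha, hb, rfl⟩ := hx
      obtain ⟨I, rfl⟩ := hy
      exact ⟨_, (ee_mul_EF_eq_merge ha hb).symm⟩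
  · rintro _ ⟨I, rfl⟩
    exact blockMonoid_le I (EF_mem_blockMonoid I)

end PartitionIdempotents

/-! ### Spanning: the tower of subalgebras A_k -/

section Spanning

variable {n : ℕ}

/-- The idempotent is lengthened at its right end, by T_{i+d+1}, which commutes with B_1; the
recursion defining `Eaux` would use T_i, which need not when i = 1. -/
theorem commute_B_Eaux {d i : ℕ} (hi : 1 ≤ i) (hd : i + d < n) :
    Commute (B₁ n) (Eaux n d i) := by
  induction d with
  | zero => exact commute_B_E ⟨hi, hd⟩
  | succ d ih =>
    have h := semiconjBy_T_Eaux_last_succ (n := n) (d := d) hi (by omega)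
    have hB : Commute (B₁ n) (T n (i + d + 1)) := commute_B_T ⟨by omega, by omega⟩
    have h1 : Eaux n (d + 1) i =
        T n (i + d + 1) * Eaux n d i * ((Tu n (i + d + 1))⁻¹ : (Alg n)ˣ) := by
      rw [h.eq, mul_assoc, T_mul_Tu_inv, mul_one]
    rw [h1]
    exact (hB.mul_right (ih (by omega))).mul_right (semiconjBy_Tu_inv_right hB)

theorem commute_B_ee {a b : ℕ} (ha : a ≤ n) (hb : b ≤ n) : Commute (B₁ n) (ee n a b) := by
  wlog hab : a ≤ b generalizing a b
  · rw [ee_comm a]; exact this hb ha (by omega)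
  rcases hab.eq_or_lt with rfl | hab
  · rw [ee_self]; exact Commute.one_right _
  rcases Nat.eq_zero_or_pos a with rfl | ha0
  · rw [ee_zero_left hab]; exact commute_B_F ⟨hab, hb⟩
  obtain ⟨d, rfl⟩ : ∃ d, b = a + d + 1 := ⟨b - a - 1, by omega⟩
  rw [ee_Eaux ha0]
  exact commute_B_Eaux ha0 (by omega)

theorem semiconjBy_T_Bk {k : ℕ} : SemiconjBy (T n (k + 1)) (Bk n (k + 1)) (Bk n (k + 2)) := by
  change _ = T n (k + 1) * _ * _ * _
  rw [mul_assoc _ _ (T n (k + 1)), Tu_inv_mul_T, mul_one]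

theorem swap_le {k a : ℕ} (hk : k < n) (ha : a ≤ n) : Equiv.swap k (k + 1) a ≤ n := by
  rw [Equiv.swap_apply_def]
  split_ifs <;> omega

theorem commute_Bk_ee {k a b : ℕ} (hk : k + 1 ≤ n) (ha : a ≤ n) (hb : b ≤ n) :
    Commute (Bk n (k + 1)) (ee n a b) := by
  induction k generalizing a b with
  | zero => exact commute_B_ee ha hb
  | succ k ih =>
    have hk' : 1 ≤ k + 1 ∧ k + 1 < n := ⟨by omega, by omega⟩
    have ha' := swap_le hk'.2 ha
    have hb' := swap_le hk'.2 hb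
    have h1 := semiconjBy_T_ee hk' ha hb
    have h2 := semiconjBy_T_ee hk' ha' hb'
    rw [Equiv.swap_apply_self, Equiv.swap_apply_self] at h2
    exact (SemiconjBy.mul_left h2 (ih (by omega) ha' hb')).mul_left (semiconjBy_Tu_inv_left h2)

theorem commute_T_Bk_of_gt {k i : ℕ} (hk : k + 1 < i) (hi : i < n) :
    Commute (T n i) (Bk n (k + 1)) := by
  induction k with
  | zero => exact (commute_B_T ⟨by omega, hi⟩).symm
  | succ k ih =>
    have h : Commute (T n i) (T n (k + 1)) :=
      commute_T_T ⟨by omega, by omega⟩ ⟨by omega, by omega⟩ (Or.inr (by omega))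
    exact (h.mul_right (ih (by omega))).mul_right (semiconjBy_Tu_inv_right h)

theorem commute_T_Bk_of_lt {k i : ℕ} (hi : 1 ≤ i) (hik : i < k + 1) (hk : k + 1 < n) :
    Commute (T n i) (Bk n (k + 2)) := by
  induction k with
  | zero => omega
  | succ k ih =>
    rcases Nat.lt_or_ge i (k + 1) with h1 | h1
    · have h : Commute (T n i) (T n (k + 1 + 1)) :=
        commute_T_T ⟨by omega, by omega⟩ ⟨by omega, by omega⟩ (Or.inl (by omega))
      exact (h.mul_right (ih h1 (by omega))).mul_right (semiconjBy_Tu_inv_right h)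
    · obtain rfl : i = k + 1 := by omega
      -- Both T_{k+2}T_{k+1}T_{k+2} and T_{k+2}T_{k+1} carry B_{k+1} to B_{k+3}; by the braid
      -- relation their quotient is T_{k+1}.
      have h2 : SemiconjBy (T n (k + 1 + 1) * T n (k + 1) * T n (k + 1 + 1)) (Bk n (k + 1))
          (Bk n (k + 1 + 2)) :=
        (semiconjBy_T_Bk.mul_left semiconjBy_T_Bk).mul_left
          (commute_T_Bk_of_gt (by omega) (by omega))
      rw [← braid_T ⟨by omega, by omega⟩] at h2
      have h3 := (h2.mul_left (semiconjBy_Tu_inv_left semiconjBy_T_Bk)).mul_left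
        (semiconjBy_Tu_inv_left semiconjBy_T_Bk)
      rwa [mul_assoc _ (T n (k + 1)), T_mul_Tu_inv, mul_one, mul_assoc, T_mul_Tu_inv, mul_one] at h3

theorem commute_T_of_mem_M {k i : ℕ} (hk : k + 1 < i) (hi : i < n) {x : Alg n}
    (hx : x ∈ M n (k + 1)) : Commute (T n i) x := by
  induction k generalizing x with
  | zero =>
    rcases hx with rfl | rfl
    · exact Commute.one_right _
    · exact commute_T_Bk_of_gt hk hi
  | succ k ih =>
    rcases hx with (rfl | rfl) | ⟨y, hy, rfl⟩
    · exact Commute.one_right _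
    · exact commute_T_Bk_of_gt hk hi
    · exact (commute_T_T ⟨by omega, by omega⟩ ⟨by omega, by omega⟩ (Or.inr (by omega))).mul_right
        (ih (by omega) hy)

/-- The generators `ee n a b`, `B₁` (if `1 ≤ k`) and `T₁, …, T_{k-1}`. -/
def partialGens (n k : ℕ) : Set (Alg n) :=
  {x | ∃ a b, a ≤ n ∧ b ≤ n ∧ x = ee n a b} ∪ {x | 1 ≤ k ∧ x = B₁ n} ∪
    {x | ∃ i, 1 ≤ i ∧ i < k ∧ x = T n i}

/-- The subalgebra generated by the `ee n a b`, `B₁` (if `1 ≤ k`) and `T₁, …, T_{k-1}`. -/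
noncomputable def partialAlg (n k : ℕ) : Subalgebra K (Alg n) := Algebra.adjoin K (partialGens n k)

theorem ee_mem_partialAlg {k a b : ℕ} (ha : a ≤ n) (hb : b ≤ n) : ee n a b ∈ partialAlg n k :=
  Algebra.subset_adjoin (Or.inl (Or.inl ⟨a, b, ha, hb, rfl⟩))

theorem B_mem_partialAlg {k : ℕ} (hk : 1 ≤ k) : B₁ n ∈ partialAlg n k :=
  Algebra.subset_adjoin (Or.inl (Or.inr ⟨hk, rfl⟩))

theorem T_mem_partialAlg {k i : ℕ} (hi : 1 ≤ i) (hk : i < k) : T n i ∈ partialAlg n k :=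
  Algebra.subset_adjoin (Or.inr ⟨i, hi, hk, rfl⟩)

theorem Tu_inv_mem_partialAlg {k i : ℕ} (hi : 1 ≤ i) (hk : i < k) (hin : i < n) :
    (((Tu n i)⁻¹ : (Alg n)ˣ) : Alg n) ∈ partialAlg n k := by
  rw [Tu_inv ⟨hi, hin⟩, ← ee_succ hi]
  exact sub_mem (T_mem_partialAlg hi hk)
    (Subalgebra.smul_mem _ (ee_mem_partialAlg (by omega) (by omega)) _)

theorem partialAlg_mono {k l : ℕ} (h : k ≤ l) : partialAlg n k ≤ partialAlg n l := by
  refine Algebra.adjoin_mono ?_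
  rintro x ((hx | ⟨hk, rfl⟩) | ⟨i, hi, hk, rfl⟩)
  · exact Or.inl (Or.inl hx)
  · exact Or.inl (Or.inr ⟨by omega, rfl⟩)
  · exact Or.inr ⟨i, hi, by omega, rfl⟩

theorem Bk_mem_partialAlg {k : ℕ} (hk : k + 1 ≤ n) : Bk n (k + 1) ∈ partialAlg n (k + 1) := by
  induction k with
  | zero => exact B_mem_partialAlg le_rfl
  | succ k ih =>
    exact mul_mem (mul_mem (T_mem_partialAlg (by omega) (by omega))
      (partialAlg_mono (by omega) (ih (by omega))))
      (Tu_inv_mem_partialAlg (by omega) (by omega) (by omega))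

theorem M_subset_partialAlg {k : ℕ} (hk : k + 1 ≤ n) {x : Alg n} (hx : x ∈ M n (k + 1)) :
    x ∈ partialAlg n (k + 1) := by
  induction k generalizing x with
  | zero =>
    rcases hx with rfl | rfl
    · exact one_mem _
    · exact Bk_mem_partialAlg hk
  | succ k ih =>
    rcases hx with (rfl | rfl) | ⟨y, hy, rfl⟩
    · exact one_mem _
    · exact Bk_mem_partialAlg hk
    · exact mul_mem (T_mem_partialAlg (by omega) (by omega))
        (partialAlg_mono (by omega) (ih (by omega) hy))

theorem one_mem_M (k : ℕ) : 1 ∈ M n (k + 1) := by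
  cases k with
  | zero => exact Or.inl rfl
  | succ k => exact Or.inl (Or.inl rfl)

theorem Bk_mem_M (k : ℕ) : Bk n (k + 1) ∈ M n (k + 1) := by
  cases k with
  | zero => exact Or.inr rfl
  | succ k => exact Or.inl (Or.inr rfl)

/-- T_{k+1} permutes the pair idempotents and commutes with the other generators of A_k, whose
indices are too far away. Coefficients from A_k can therefore be moved to the left of T_{k+1}. -/
theorem exists_T_mul_eq {k : ℕ} (hk : k + 1 < n) {a : Alg n} (ha : a ∈ partialAlg n k) :
    ∃ b ∈ partialAlg n k, SemiconjBy (T n (k + 1)) a b := by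
  induction ha using Algebra.adjoin_induction with
  | mem x hx =>
    rcases hx with (⟨a, b, ha, hb, rfl⟩ | ⟨hk', rfl⟩) | ⟨i, hi, hik, rfl⟩
    · exact ⟨_, ee_mem_partialAlg (swap_le hk ha) (swap_le hk hb),
        semiconjBy_T_ee ⟨by omega, hk⟩ ha hb⟩
    · exact ⟨_, B_mem_partialAlg hk', (commute_B_T ⟨by omega, hk⟩).symm⟩
    · exact ⟨_, T_mem_partialAlg hi hik,
        commute_T_T ⟨by omega, hk⟩ ⟨hi, by omega⟩ (Or.inr (by omega))⟩
  | algebraMap r => exact ⟨_, Subalgebra.algebraMap_mem _ r, (Algebra.commutes r _).symm⟩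
  | add x y _ _ hx hy =>
    obtain ⟨x', hx', h1⟩ := hx
    obtain ⟨y', hy', h2⟩ := hy
    exact ⟨_, add_mem hx' hy', h1.add_right h2⟩
  | mul x y _ _ hx hy =>
    obtain ⟨x', hx', h1⟩ := hx
    obtain ⟨y', hy', h2⟩ := hy
    exact ⟨_, mul_mem hx' hy', h1.mul_right h2⟩

theorem exists_mul_Tu_inv_eq {k : ℕ} (hk : k + 1 < n) {a : Alg n} (ha : a ∈ partialAlg n k) :
    ∃ b ∈ partialAlg n k, a * ((Tu n (k + 1))⁻¹ : (Alg n)ˣ) =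
      ((Tu n (k + 1))⁻¹ : (Alg n)ˣ) * b := by
  obtain ⟨b, hb, h⟩ := exists_T_mul_eq hk ha
  exact ⟨b, hb, (semiconjBy_Tu_inv_left h).eq.symm⟩

/-- The span of the products `a * m` with `a ∈ partialAlg n k` and `m ∈ M_{k+1}`. -/
noncomputable def stepSpan (n k : ℕ) : Submodule K (Alg n) :=
  Subalgebra.toSubmodule (partialAlg n k) * Submodule.span K (M n (k + 1))

theorem mul_mem_stepSpan {k : ℕ} {a m : Alg n} (ha : a ∈ partialAlg n k) (hm : m ∈ M n (k + 1)) :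
    a * m ∈ stepSpan n k :=
  Submodule.mul_mem_mul ha (Submodule.subset_span hm)

theorem mul_stepSpan {k : ℕ} {a x : Alg n} (ha : a ∈ partialAlg n k) (hx : x ∈ stepSpan n k) :
    a * x ∈ stepSpan n k := by
  induction hx using Submodule.mul_induction_on' with
  | mem_mul_mem b hb m hm =>
    rw [← mul_assoc]
    exact Submodule.mul_mem_mul ((partialAlg n k).mul_mem ha hb) hm
  | add x _ y _ hx hy =>
    rw [mul_add]
    exact add_mem hx hy

theorem stepSpan_mul {k : ℕ} {x y : Alg n} (hx : x ∈ stepSpan n k)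
    (h : ∀ m ∈ M n (k + 1), m * y ∈ stepSpan n k) : x * y ∈ stepSpan n k := by
  induction hx using Submodule.mul_induction_on' with
  | mem_mul_mem b hb m hm =>
    rw [mul_assoc]
    refine mul_stepSpan hb ?_
    induction hm using Submodule.span_induction with
    | mem m hm => exact h m hm
    | zero => rw [zero_mul]; exact zero_mem _
    | add m m' _ _ h1 h2 => rw [add_mul]; exact add_mem h1 h2
    | smul c m _ h1 => rw [smul_mul_assoc]; exact Submodule.smul_mem _ _ h1
  | add x _ z _ hx hz =>
    rw [add_mul]
    exact add_mem hx hz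

/-- The step span contains 1, so stability under right multiplication by generators puts every word
in it; as it is a left A_k-module, only left factors from M_{k+1} need checking. -/
theorem partialAlg_le_stepSpan {k : ℕ}
    (h : ∀ y ∈ partialGens n (k + 1), ∀ m ∈ M n (k + 1), m * y ∈ stepSpan n k) :
    Subalgebra.toSubmodule (partialAlg n (k + 1)) ≤ stepSpan n k := by
  rw [partialAlg, Algebra.adjoin_eq_span, Submodule.span_le]
  intro x hx
  induction hx using Submonoid.closure_induction_right with
  | one => simpa using mul_mem_stepSpan (one_mem (partialAlg n k)) (one_mem_M k)
  | mul_right x _ y hy hx => exact stepSpan_mul hx (h y hy)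

theorem stepSpan_le_partialAlg {k : ℕ} (hk : k + 1 ≤ n) :
    stepSpan n k ≤ Subalgebra.toSubmodule (partialAlg n (k + 1)) := by
  refine Submodule.mul_le.2 fun a ha m hm =>
    (partialAlg n (k + 1)).mul_mem (partialAlg_mono (by omega) ha) ?_
  have : Submodule.span K (M n (k + 1)) ≤ Subalgebra.toSubmodule (partialAlg n (k + 1)) :=
    Submodule.span_le.2 fun x hx => M_subset_partialAlg hk hx
  exact this hm

theorem partialAlg_one_le_stepSpan (hn : 1 ≤ n) :
    Subalgebra.toSubmodule (partialAlg n 1) ≤ stepSpan n 0 := by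
  refine partialAlg_le_stepSpan ?_
  rintro y ((⟨a, b, ha, hb, rfl⟩ | ⟨-, rfl⟩) | ⟨i, hi, hik, rfl⟩) m hm
  · have hc : Commute m (ee n a b) := by
      rcases hm with rfl | rfl
      · exact Commute.one_left _
      · exact commute_B_ee ha hb
    rw [hc.eq]
    exact mul_mem_stepSpan (ee_mem_partialAlg ha hb) hm
  · rcases hm with rfl | rfl
    · rw [one_mul]
      simpa [Bk] using mul_mem_stepSpan (one_mem (partialAlg n 0)) (Bk_mem_M (n := n) 0)
    · change B₁ n * B₁ n ∈ _
      rw [B_sq, ← smul_mul_assoc, ← ee_zero_left le_rfl]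
      refine add_mem ?_ (mul_mem_stepSpan (Subalgebra.smul_mem _
        (ee_mem_partialAlg (by omega) (by omega)) _) (Bk_mem_M (n := n) 0))
      simpa using mul_mem_stepSpan (one_mem (partialAlg n 0)) (one_mem_M (n := n) 0)
  · omega

/-- The span of the products `a * T_{k+1} * b` with `a`, `b` in `partialAlg n (k + 1)`. -/
noncomputable def doubleCosetSpan (n k : ℕ) : Submodule K (Alg n) :=
  Submodule.span K
    {x | ∃ a ∈ partialAlg n (k + 1), ∃ b ∈ partialAlg n (k + 1), x = a * T n (k + 1) * b}

/-- In the base case T_1⁻¹ = T_1 − (u − u⁻¹)E_1, and the type B braid relation cancels the terms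
without E_1. The induction conjugates by T_{k+2}, which commutes with B_1. -/
theorem Bk_mul_B_sub_mem {k : ℕ} (hk : k + 1 < n) :
    Bk n (k + 2) * B₁ n - B₁ n * Bk n (k + 2) ∈ doubleCosetSpan n k := by
  induction k with
  | zero =>
    have hT : 1 ≤ 1 ∧ 1 < n := ⟨le_rfl, hk⟩
    have hB : B₁ n ∈ partialAlg n (0 + 1) := B_mem_partialAlg le_rfl
    have hE : E n 1 ∈ partialAlg n (0 + 1) := by
      rw [← ee_succ le_rfl]; exact ee_mem_partialAlg (by omega) (by omega)
    have h : Bk n 2 * B₁ n - B₁ n * Bk n 2 = (u - u⁻¹) • (B₁ n * T n 1 * (B₁ n * E n 1)) -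
        (u - u⁻¹) • (1 * T n 1 * (B₁ n * E n 1 * B₁ n)) := by
      change T n 1 * B₁ n * ((Tu n 1)⁻¹ : (Alg n)ˣ) * B₁ n -
        B₁ n * (T n 1 * B₁ n * ((Tu n 1)⁻¹ : (Alg n)ˣ)) = _
      rw [Tu_inv hT]
      simp only [mul_sub, sub_mul, mul_smul_comm, smul_mul_assoc, one_mul, ← mul_assoc]
      rw [braid_B hk]
      abel
    rw [h]
    exact sub_mem (Submodule.smul_mem _ _ (Submodule.subset_span ⟨_, hB, _, mul_mem hB hE, rfl⟩))
      (Submodule.smul_mem _ _ (Submodule.subset_span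
        ⟨_, one_mem _, _, mul_mem (mul_mem hB hE) hB, rfl⟩))
  | succ k ih =>
    have hB : Commute (B₁ n) (T n (k + 2)) := commute_B_T ⟨by omega, hk⟩
    have hB' := semiconjBy_Tu_inv_right hB
    have h : Bk n (k + 1 + 2) * B₁ n - B₁ n * Bk n (k + 1 + 2) =
        T n (k + 2) * (Bk n (k + 2) * B₁ n - B₁ n * Bk n (k + 2)) *
          ((Tu n (k + 2))⁻¹ : (Alg n)ˣ) := by
      change T n (k + 2) * Bk n (k + 2) * ((Tu n (k + 2))⁻¹ : (Alg n)ˣ) * B₁ n -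
        B₁ n * (T n (k + 2) * Bk n (k + 2) * ((Tu n (k + 2))⁻¹ : (Alg n)ˣ)) = _
      rw [mul_assoc _ _ (B₁ n), ← hB'.eq, ← mul_assoc (B₁ n), ← mul_assoc (B₁ n), hB.eq, mul_sub,
        sub_mul]
      simp only [mul_assoc]
    rw [h]
    have ih' := ih (by omega)
    generalize Bk n (k + 2) * B₁ n - B₁ n * Bk n (k + 2) = x at ih'
    induction ih' using Submodule.span_induction with
    | mem x hx =>
      obtain ⟨a, ha, b, hb, rfl⟩ := hx
      obtain ⟨a', ha', h1⟩ := exists_T_mul_eq hk ha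
      obtain ⟨b', hb', h2⟩ := exists_mul_Tu_inv_eq hk hb
      -- The braid relation leaves a single T_{k+2}, flanked by factors of A_{k+2}.
      have h3 : T n (k + 2) * T n (k + 1) * ((Tu n (k + 2))⁻¹ : (Alg n)ˣ) =
          ((Tu n (k + 1))⁻¹ : (Alg n)ˣ) * T n (k + 2) * T n (k + 1) := by
        have hb := braid_T (n := n) (i := k + 1) ⟨by omega, hk⟩
        refine (isUnit_T n (k + 1)).mul_left_cancel ?_
        refine (isUnit_T n (k + 2)).mul_right_cancel ?_
        rw [← mul_assoc, ← mul_assoc, hb, mul_assoc _ _ (T n (k + 2)), Tu_inv_mul_T, mul_one,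
          ← mul_assoc, ← mul_assoc, T_mul_Tu_inv, one_mul]
      refine Submodule.subset_span ⟨a' * ((Tu n (k + 1))⁻¹ : (Alg n)ˣ), mul_mem
        (partialAlg_mono (by omega) ha') (Tu_inv_mem_partialAlg (by omega) (by omega) (by omega)),
        T n (k + 1) * b', mul_mem (T_mem_partialAlg (by omega) (by omega))
        (partialAlg_mono (by omega) hb'), ?_⟩
      calc T n (k + 2) * (a * T n (k + 1) * b) * ((Tu n (k + 2))⁻¹ : (Alg n)ˣ)
          = T n (k + 2) * a * T n (k + 1) * (b * ((Tu n (k + 2))⁻¹ : (Alg n)ˣ)) := by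
            simp only [mul_assoc]
        _ = a' * (T n (k + 2) * T n (k + 1) * ((Tu n (k + 2))⁻¹ : (Alg n)ˣ)) * b' := by
            rw [h1.eq, h2]; simp only [mul_assoc]
        _ = _ := by rw [h3]; simp only [mul_assoc]
    | zero => simp
    | add x y _ _ hx hy => rw [mul_add, add_mul]; exact add_mem hx hy
    | smul c x _ hx => rw [mul_smul_comm, smul_mul_assoc]; exact Submodule.smul_mem _ _ hx

/-- By `ih`, a is a sum of products bm with b in A_k and m in the span of M_{k+1}; T_{k+1} passes b,
and T_{k+1}M_{k+1} is part of M_{k+2}. -/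
theorem T_mul_mem_stepSpan {k : ℕ} (hk : k + 1 < n)
    (ih : Subalgebra.toSubmodule (partialAlg n (k + 1)) ≤ stepSpan n k) {a : Alg n}
    (ha : a ∈ partialAlg n (k + 1)) : T n (k + 1) * a ∈ stepSpan n (k + 1) := by
  have ha' : a ∈ stepSpan n k := ih ha
  induction ha' using Submodule.mul_induction_on' with
  | mem_mul_mem b hb m hm =>
    obtain ⟨b', hb', h⟩ := exists_T_mul_eq hk hb
    rw [← mul_assoc, h.eq, mul_assoc]
    refine Submodule.mul_mem_mul (partialAlg_mono (by omega) hb') ?_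
    clear ha
    induction hm using Submodule.span_induction with
    | mem m hm => exact Submodule.subset_span (Or.inr ⟨m, hm, rfl⟩)
    | zero => rw [mul_zero]; exact zero_mem _
    | add m m' _ _ h1 h2 => rw [mul_add]; exact add_mem h1 h2
    | smul c m _ h1 => rw [mul_smul_comm]; exact Submodule.smul_mem _ _ h1
  | add x hx y hy h1 h2 =>
    rw [mul_add]
    exact add_mem (h1 (stepSpan_le_partialAlg (by omega) hx))
      (h2 (stepSpan_le_partialAlg (by omega) hy))

theorem partialAlg_succ_le_stepSpan {k : ℕ} (hk : k + 1 < n)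
    (ih : Subalgebra.toSubmodule (partialAlg n (k + 1)) ≤ stepSpan n k) :
    Subalgebra.toSubmodule (partialAlg n (k + 2)) ≤ stepSpan n (k + 1) := by
  have hT : 1 ≤ k + 1 ∧ k + 1 < n := ⟨by omega, hk⟩
  have hM {m : Alg n} (hm : m ∈ M n (k + 2)) : m ∈ stepSpan n (k + 1) := by
    simpa using mul_mem_stepSpan (one_mem _) hm
  have hA {a : Alg n} (ha : a ∈ partialAlg n (k + 1)) : a ∈ stepSpan n (k + 1) := by
    simpa using mul_mem_stepSpan ha (one_mem_M (k + 1))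
  have hEmem : E n (k + 1) ∈ partialAlg n (k + 1) := by
    rw [← ee_succ (by omega)]
    exact ee_mem_partialAlg (by omega) (by omega)
  have hTM : ∀ m ∈ M n (k + 1), ∀ y ∈ partialAlg n (k + 1),
      T n (k + 1) * m * y ∈ stepSpan n (k + 1) := fun m hm y hy => by
    rw [mul_assoc]
    exact T_mul_mem_stepSpan hk ih (mul_mem (M_subset_partialAlg (by omega) hm) hy)
  have hBB : Bk n (k + 2) * B₁ n ∈ stepSpan n (k + 1) := by
    have h : doubleCosetSpan n k ≤ stepSpan n (k + 1) := by
      refine Submodule.span_le.2 ?_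
      rintro _ ⟨a, ha, b, hb, rfl⟩
      rw [mul_assoc]
      exact mul_stepSpan ha (T_mul_mem_stepSpan hk ih hb)
    rw [← sub_add_cancel (Bk n (k + 2) * B₁ n) (B₁ n * Bk n (k + 2))]
    exact add_mem (h (Bk_mul_B_sub_mem hk))
      (mul_mem_stepSpan (B_mem_partialAlg (by omega)) (Bk_mem_M _))
  refine partialAlg_le_stepSpan ?_
  rintro y hy m ((rfl | rfl) | ⟨m, hm, rfl⟩)
  · rw [one_mul]
    rcases hy with (⟨a, b, ha, hb, rfl⟩ | ⟨-, rfl⟩) | ⟨i, hi, hik, rfl⟩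
    · exact hA (ee_mem_partialAlg ha hb)
    · exact hA (B_mem_partialAlg (by omega))
    · rcases (Nat.lt_succ_iff.1 hik).eq_or_lt with rfl | hik
      · exact hM (Or.inr ⟨1, one_mem_M _, (mul_one _).symm⟩)
      · exact hA (T_mem_partialAlg hi hik)
  · rcases hy with (⟨a, b, ha, hb, rfl⟩ | ⟨-, rfl⟩) | ⟨i, hi, hik, rfl⟩
    · rw [(commute_Bk_ee hk ha hb).eq]
      exact mul_mem_stepSpan (ee_mem_partialAlg ha hb) (Bk_mem_M _)
    · exact hBB
    · rcases (Nat.lt_succ_iff.1 hik).eq_or_lt with rfl | hik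
      · rw [← semiconjBy_T_Bk.eq]
        exact hM (Or.inr ⟨_, Bk_mem_M _, rfl⟩)
      · rw [← (commute_T_Bk_of_lt hi hik hk).eq]
        exact mul_mem_stepSpan (T_mem_partialAlg hi hik) (Bk_mem_M _)
  · rcases hy with (⟨a, b, ha, hb, rfl⟩ | ⟨-, rfl⟩) | ⟨i, hi, hik, rfl⟩
    · exact hTM m hm _ (ee_mem_partialAlg ha hb)
    · exact hTM m hm _ (B_mem_partialAlg (by omega))
    rcases (Nat.lt_succ_iff.1 hik).eq_or_lt with rfl | hik
    swap
    · exact hTM m hm _ (T_mem_partialAlg hi hik)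
    have h1 : T n (k + 1) * T n (k + 1) ∈ stepSpan n (k + 1) := by
      rw [T_sq hT, ← smul_mul_assoc]
      refine add_mem (hM (one_mem_M _)) (mul_mem_stepSpan (Subalgebra.smul_mem _ hEmem _) ?_)
      exact Or.inr ⟨1, one_mem_M _, (mul_one _).symm⟩
    -- The product is B_{k+2}T_{k+1}²; the second term of the quadratic relation contributes
    -- B_{k+2}T_{k+1}E_{k+1} = T_{k+1}B_{k+1}E_{k+1}.
    have h2 : T n (k + 1) * Bk n (k + 1) * T n (k + 1) ∈ stepSpan n (k + 1) := by
      rw [semiconjBy_T_Bk.eq, mul_assoc, T_sq hT, E_mul_T hT, mul_add, mul_one, mul_smul_comm,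
        ← mul_assoc, ← semiconjBy_T_Bk.eq]
      exact add_mem (hM (Bk_mem_M _)) (Submodule.smul_mem _ _ (hTM _ (Bk_mem_M _) _ hEmem))
    cases k with
    | zero =>
      rcases hm with rfl | rfl
      · rwa [mul_one]
      · exact h2
    | succ k =>
      rcases hm with (rfl | rfl) | ⟨m, hm, rfl⟩
      · rwa [mul_one]
      · exact h2
      -- As m commutes with T_{k+2}, the braid relation turns T_{k+2}T_{k+1}mT_{k+2} into
      -- T_{k+1}·T_{k+2}T_{k+1}m.
      · rw [mul_assoc, mul_assoc, ← (commute_T_of_mem_M (by omega) hk hm).eq, ← mul_assoc (T n _),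
          ← mul_assoc, ← braid_T ⟨by omega, hk⟩, mul_assoc, mul_assoc]
        exact mul_mem_stepSpan (T_mem_partialAlg (by omega) (by omega))
          (Or.inr ⟨_, Or.inr ⟨m, hm, rfl⟩, rfl⟩)

theorem partialAlg_eq_stepSpan {k : ℕ} (hk : k + 1 ≤ n) :
    Subalgebra.toSubmodule (partialAlg n (k + 1)) = stepSpan n k := by
  refine le_antisymm ?_ (stepSpan_le_partialAlg hk)
  induction k with
  | zero => exact partialAlg_one_le_stepSpan hk
  | succ k ih => exact partialAlg_succ_le_stepSpan hk (ih (by omega))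

open scoped Pointwise in
theorem partialAlg_eq_span {k : ℕ} (hk : k ≤ n) :
    Subalgebra.toSubmodule (partialAlg n k) = Submodule.span K
      (Set.range (EF (n := n)) * (List.ofFn fun i : Fin k => M n (i + 1)).prod) := by
  induction k with
  | zero =>
    have h : partialGens n 0 = {x | ∃ a b, a ≤ n ∧ b ≤ n ∧ x = ee n a b} := by
      simp [partialGens]
    rw [partialAlg, Algebra.adjoin_eq_span, h, List.ofFn_zero, List.prod_nil, mul_one,
      ← pairMonoid_eq_range, pairMonoid]
  | succ k ih =>
    rw [partialAlg_eq_stepSpan hk, stepSpan, ih (by omega), Submodule.span_mul_span, List.ofFn_succ',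
      List.concat_eq_append, List.prod_append, List.prod_singleton, mul_assoc]
    simp

theorem partialAlg_eq_top (hn : 1 ≤ n) : partialAlg n n = ⊤ := by
  have h : (Algebra.adjoin K (Set.range (FreeAlgebra.ι K (X := Gen n)))).map (proj n) = ⊤ := by
    rw [FreeAlgebra.adjoin_range_ι, Algebra.map_top, AlgHom.range_eq_top]
    exact RingQuot.mkAlgHom_surjective K (Rel n)
  rw [AlgHom.map_adjoin] at h
  rw [eq_top_iff, ← h]
  refine Algebra.adjoin_le ?_
  rintro _ ⟨_, ⟨g, rfl⟩, rfl⟩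
  cases g with
  | B => exact B_mem_partialAlg hn
  | T i h =>
    have := T_mem_partialAlg (n := n) h.1 h.2
    simpa [T, Free.t, h] using this
  | E i h =>
    have := ee_mem_partialAlg (n := n) (k := n) (a := i) (b := i + 1) (by omega) (by omega)
    rw [ee_succ h.1] at this
    simpa [E, Free.e, h] using this
  | F j h =>
    have := ee_mem_partialAlg (n := n) (k := n) (a := 0) (b := j) (by omega) (by omega)
    rw [ee_zero_left h.1] at this
    simpa [F, Free.f, h] using this

theorem span_C (hn : 1 ≤ n) : Submodule.span K (C n) = ⊤ := by
  have h := partialAlg_eq_span (n := n) le_rfl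
  rw [partialAlg_eq_top hn, Algebra.top_toSubmodule] at h
  rw [h]
  congr 1
  ext x
  rw [Set.mem_mul]
  constructor
  · rintro ⟨⟨I, m⟩, rfl⟩
    exact ⟨_, ⟨I, rfl⟩, _, Set.mem_prod_list_ofFn.2 ⟨m, rfl⟩, rfl⟩
  · rintro ⟨_, ⟨I, rfl⟩, y, hy, rfl⟩
    obtain ⟨m, rfl⟩ := Set.mem_prod_list_ofFn.1 hy
    exact ⟨(I, m), rfl⟩

end Spanning

/-- A state: a color and a nonzero integer at each position, the integers having pairwise distinct
absolute values. -/
@[ext]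
structure State : Type where
  col : ℕ → ℕ
  val : ℕ → ℤ
  val_ne : ∀ i, val i ≠ 0
  ne_of_ne : ∀ i j, i ≠ j → val i ≠ val j ∧ val i ≠ -val j

/-! ### Swaps and sign changes of colored signed words -/

namespace State

/-- Exchange of the positions `i` and `i + 1`. -/
def swap (i : ℕ) (s : State) : State where
  col j := s.col (Equiv.swap i (i + 1) j)
  val j := s.val (Equiv.swap i (i + 1) j)
  val_ne _ := s.val_ne _
  ne_of_ne _ _ h := s.ne_of_ne _ _ fun h' => h (Equiv.injective _ h')

/-- Change of the sign at position `k`. -/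
def flip (k : ℕ) (s : State) : State where
  col := s.col
  val j := if j = k then -s.val j else s.val j
  val_ne j := by have := s.val_ne j; split_ifs <;> omega
  ne_of_ne i j h := by have := s.ne_of_ne i j h; split_ifs <;> omega

variable (s : State) {i j k : ℕ}

theorem col_swap : (s.swap i).col j = s.col (Equiv.swap i (i + 1) j) := rfl

theorem val_swap : (s.swap i).val j = s.val (Equiv.swap i (i + 1) j) := rfl

@[simp] theorem col_flip : (s.flip k).col = s.col := rfl

theorem val_flip : (s.flip k).val j = if j = k then -s.val j else s.val j := rfl

@[simp] theorem col_swap_left : (s.swap i).col i = s.col (i + 1) := by simp [col_swap]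
@[simp] theorem col_swap_right : (s.swap i).col (i + 1) = s.col i := by simp [col_swap]
@[simp] theorem val_swap_left : (s.swap i).val i = s.val (i + 1) := by simp [val_swap]
@[simp] theorem val_swap_right : (s.swap i).val (i + 1) = s.val i := by simp [val_swap]

theorem col_swap_of_ne (h : j ≠ i) (h' : j ≠ i + 1) : (s.swap i).col j = s.col j := by
  rw [col_swap, Equiv.swap_apply_of_ne_of_ne h h']

theorem val_swap_of_ne (h : j ≠ i) (h' : j ≠ i + 1) : (s.swap i).val j = s.val j := by
  rw [val_swap, Equiv.swap_apply_of_ne_of_ne h h']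

@[simp] theorem val_flip_self : (s.flip k).val k = -s.val k := by simp [val_flip]

theorem val_flip_of_ne (h : j ≠ k) : (s.flip k).val j = s.val j := by simp [val_flip, h]

@[simp] theorem swap_swap : (s.swap i).swap i = s := by
  ext j <;> simp [col_swap, val_swap]

@[simp] theorem flip_flip : (s.flip k).flip k = s := by
  ext j
  · rfl
  · by_cases h : j = k <;> simp [val_flip, h]

theorem swap_comm (h : i + 1 < j ∨ j + 1 < i) : (s.swap i).swap j = (s.swap j).swap i := by
  have key : ∀ x, Equiv.swap i (i + 1) (Equiv.swap j (j + 1) x) =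
      Equiv.swap j (j + 1) (Equiv.swap i (i + 1) x) := by
    intro x
    simp only [Equiv.swap_apply_def]
    split_ifs <;> omega
  ext x <;> simp [col_swap, val_swap, key]

theorem swap_braid : ((s.swap i).swap (i + 1)).swap i = ((s.swap (i + 1)).swap i).swap (i + 1) := by
  have key : ∀ x, Equiv.swap i (i + 1) (Equiv.swap (i + 1) (i + 1 + 1) (Equiv.swap i (i + 1) x)) =
      Equiv.swap (i + 1) (i + 1 + 1) (Equiv.swap i (i + 1)
        (Equiv.swap (i + 1) (i + 1 + 1) x)) := by
    intro x
    simp only [Equiv.swap_apply_def]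
    split_ifs <;> omega
  ext x <;> simp [col_swap, val_swap, key]

theorem flip_swap_of_ne (h : k ≠ i) (h' : k ≠ i + 1) :
    (s.swap i).flip k = (s.flip k).swap i := by
  ext x
  · rfl
  · have key : Equiv.swap i (i + 1) x = k ↔ x = k := by
      rw [Equiv.swap_apply_def]
      split_ifs <;> omega
    simp [val_flip, val_swap, key]

theorem flip_succ_eq : s.flip (i + 1) = ((s.swap i).flip i).swap i := by
  ext x
  · simp [col_swap]
  · have key : Equiv.swap i (i + 1) x = i ↔ x = i + 1 := by
      rw [Equiv.swap_apply_def]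
      split_ifs <;> omega
    simp [val_flip, val_swap, key]

theorem flip_comm : (s.flip i).flip j = (s.flip j).flip i := by
  ext x
  · rfl
  · simp only [val_flip]
    split_ifs <;> rfl

end State

/-! ### The operators and their relations over a commutative ring -/

section Operators

variable {A : Type*} [CommRing A]

/-- The operator of `T_i` on functions of the states. -/
def opT (q : A) (i : ℕ) : Module.End A (State → A) where
  toFun f s := f (s.swap i) + if s.col i = s.col (i + 1) ∧ s.val (i + 1) < s.val i then q * f s else 0
  map_add' f g := by ext s; simp only [Pi.add_apply]; split_ifs <;> ring
  map_smul' c f := by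
    ext s; simp only [Pi.smul_apply, smul_eq_mul, RingHom.id_apply]; split_ifs <;> ring

/-- The operator of `B₁` on functions of the states. -/
def opB (p : A) : Module.End A (State → A) where
  toFun f s := f (s.flip 1) + if s.col 1 = s.col 0 ∧ s.val 1 < 0 then p * f s else 0
  map_add' f g := by ext s; simp only [Pi.add_apply]; split_ifs <;> ring
  map_smul' c f := by
    ext s; simp only [Pi.smul_apply, smul_eq_mul, RingHom.id_apply]; split_ifs <;> ring

/-- The projection to the functions supported on the states with equal colors at `a` and `b`. -/
def opP (A : Type*) [CommRing A] (a b : ℕ) : Module.End A (State → A) where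
  toFun f s := if s.col a = s.col b then f s else 0
  map_add' f g := by ext s; simp only [Pi.add_apply]; split_ifs <;> ring
  map_smul' c f := by
    ext s; simp only [Pi.smul_apply, smul_eq_mul, RingHom.id_apply]; split_ifs <;> ring

theorem opT_apply (q : A) (i : ℕ) (f : State → A) (s : State) :
    opT q i f s = f (s.swap i) +
      if s.col i = s.col (i + 1) ∧ s.val (i + 1) < s.val i then q * f s else 0 := rfl

theorem opB_apply (p : A) (f : State → A) (s : State) :
    opB p f s = f (s.flip 1) + if s.col 1 = s.col 0 ∧ s.val 1 < 0 then p * f s else 0 := rfl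

theorem opP_apply (a b : ℕ) (f : State → A) (s : State) :
    opP A a b f s = if s.col a = s.col b then f s else 0 := rfl

variable (q p : A)

theorem opT_comm {i j : ℕ} (h : i + 1 < j ∨ j + 1 < i) :
    opT q i * opT q j = opT q j * opT q i := by
  ext f s
  simp only [Module.End.mul_apply, opT_apply]
  rw [s.swap_comm h, s.col_swap_of_ne (i := i) (j := j) (by omega) (by omega),
    s.col_swap_of_ne (i := i) (j := j + 1) (by omega) (by omega),
    s.col_swap_of_ne (i := j) (j := i) (by omega) (by omega),
    s.col_swap_of_ne (i := j) (j := i + 1) (by omega) (by omega),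
    s.val_swap_of_ne (i := i) (j := j) (by omega) (by omega),
    s.val_swap_of_ne (i := i) (j := j + 1) (by omega) (by omega),
    s.val_swap_of_ne (i := j) (j := i) (by omega) (by omega),
    s.val_swap_of_ne (i := j) (j := i + 1) (by omega) (by omega)]
  split_ifs <;> ring

/-- When the colors agree, exactly one of `s` and `s.swap i` has a descent, as the two integers
differ. So the term q f(s.swap i) occurs exactly once, and q² f(s) only at a descent. -/
theorem opT_sq (i : ℕ) : opT q i * opT q i = 1 + q • (opP A i (i + 1) * opT q i) := by
  ext f s
  have h := s.ne_of_ne i (i + 1) (by omega)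
  simp only [Module.End.mul_apply, opT_apply, opP_apply, LinearMap.add_apply, Module.End.one_apply,
    LinearMap.smul_apply, Pi.add_apply, Pi.smul_apply, smul_eq_mul, State.swap_swap,
    State.col_swap_left, State.col_swap_right, State.val_swap_left, State.val_swap_right]
  split_ifs <;> first | omega | ring

theorem opT_braid (i : ℕ) :
    opT q i * opT q (i + 1) * opT q i = opT q (i + 1) * opT q i * opT q (i + 1) := by
  ext f s
  have h1 := (s.ne_of_ne i (i + 1) (by omega)).1
  have h2 := (s.ne_of_ne (i + 1) (i + 1 + 1) (by omega)).1
  have h3 := (s.ne_of_ne i (i + 1 + 1) (by omega)).1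
  have c1 (t : State) : (t.swap i).col (i + 1 + 1) = t.col (i + 1 + 1) :=
    t.col_swap_of_ne (by omega) (by omega)
  have c2 (t : State) : (t.swap (i + 1)).col i = t.col i := t.col_swap_of_ne (by omega) (by omega)
  have c3 (t : State) : (t.swap i).val (i + 1 + 1) = t.val (i + 1 + 1) :=
    t.val_swap_of_ne (by omega) (by omega)
  have c4 (t : State) : (t.swap (i + 1)).val i = t.val i := t.val_swap_of_ne (by omega) (by omega)
  simp only [Module.End.mul_apply, opT_apply, State.swap_swap, State.swap_braid,
    State.col_swap_left, State.col_swap_right, State.val_swap_left, State.val_swap_right,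
    c1, c2, c3, c4]
  generalize s.col i = a at *
  generalize s.col (i + 1) = b at *
  generalize s.col (i + 1 + 1) = c at *
  generalize s.val i = x at *
  generalize s.val (i + 1) = y at *
  generalize s.val (i + 1 + 1) = z at *
  -- Of the eight sign patterns, the two cyclic ones are contradictory; the other six are the orders
  -- of three distinct integers.
  rcases lt_or_gt_of_ne h1 with h1 | h1 <;> rcases lt_or_gt_of_ne h2 with h2 | h2 <;>
    rcases lt_or_gt_of_ne h3 with h3 | h3 <;> first | omega | skip
  all_goals
    simp only [h1, h2, h3, h1.not_gt, h2.not_gt, h3.not_gt, and_true, and_false, if_false] <;>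
      (try split_ifs) <;> first | omega | ring

theorem opB_sq : opB p * opB p = 1 + p • (opP A 1 0 * opB p) := by
  ext f s
  have h := s.val_ne 1
  simp only [Module.End.mul_apply, opB_apply, opP_apply, LinearMap.add_apply, Module.End.one_apply,
    LinearMap.smul_apply, Pi.add_apply, Pi.smul_apply, smul_eq_mul, State.flip_flip,
    State.col_flip, State.val_flip_self]
  split_ifs <;> first | omega | ring

theorem opB_opT_comm {i : ℕ} (hi : 1 < i) : opB p * opT q i = opT q i * opB p := by
  ext f s
  simp only [Module.End.mul_apply, opB_apply, opT_apply, State.col_flip]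
  rw [s.flip_swap_of_ne (by omega) (by omega), s.val_flip_of_ne (by omega),
    s.val_flip_of_ne (by omega), s.col_swap_of_ne (by omega) (by omega),
    s.col_swap_of_ne (by omega) (by omega), s.val_swap_of_ne (by omega) (by omega)]
  by_cases h1 : s.col i = s.col (i + 1) ∧ s.val (i + 1) < s.val i <;>
    by_cases h2 : s.col 1 = s.col 0 ∧ s.val 1 < 0 <;> (simp [h1, h2]; try ring)

theorem opB_braid : opB p * opT q 1 * opB p * opT q 1 = opT q 1 * opB p * opT q 1 * opB p := by
  ext f s
  have h1 := s.ne_of_ne 1 2 (by omega)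
  have h2 := s.val_ne 1
  have h3 := s.val_ne 2
  have c1 (t : State) : (t.swap 1).col 0 = t.col 0 := t.col_swap_of_ne (by omega) (by omega)
  have c2 (t : State) : (t.flip 1).val (1 + 1) = t.val (1 + 1) := t.val_flip_of_ne (by omega)
  have c3 (t : State) : (((t.flip 1).swap 1).flip 1).swap 1 = (((t.swap 1).flip 1).swap 1).flip 1 := by
    rw [← State.flip_succ_eq, ← State.flip_succ_eq, State.flip_comm]
  simp only [Module.End.mul_apply, opT_apply, opB_apply, State.swap_swap, State.flip_flip, c3,
    State.col_swap_left, State.col_swap_right, State.val_swap_left, State.val_swap_right,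
    State.col_flip, State.val_flip_self, c1, c2]
  rw [show 1 + 1 = 2 from rfl]
  generalize s.col 0 = a at *
  generalize s.col 1 = b at *
  generalize s.col 2 = c at *
  generalize s.val 1 = x at *
  generalize s.val 2 = y at *
  obtain ⟨h4, h5⟩ := h1
  -- Since x, y, 0 and −x, −y differ where needed, every comparison reduces to y < x, y < −x, x < 0
  -- or y < 0.
  have e1 : -x < y ↔ ¬ (y < -x) := by omega
  have e3 : x < -y ↔ y < -x := by omega
  have e5 : -x < -y ↔ y < x := by omega
  have e6 : x < y ↔ ¬ (y < x) := by omega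
  have e7 : -x < 0 ↔ ¬ (x < 0) := by omega
  have e8 : -y < 0 ↔ ¬ (y < 0) := by omega
  simp only [e1, e3, e5, e6, e7, e8]
  by_cases k1 : y < x <;> by_cases k2 : y < -x <;> by_cases k3 : x < 0 <;> by_cases k4 : y < 0 <;>
    first | omega | skip
  all_goals
    simp only [k1, k2, k3, k4, not_true, not_false_iff, and_true, and_false, if_false] <;>
      (try split_ifs) <;> first | omega | ring

theorem opP_comm (a b c d : ℕ) : opP A a b * opP A c d = opP A c d * opP A a b := by
  ext f s
  simp only [Module.End.mul_apply, opP_apply]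
  split_ifs <;> rfl

theorem opP_mul_self (a b : ℕ) : opP A a b * opP A a b = opP A a b := by
  ext f s
  simp only [Module.End.mul_apply, opP_apply]
  split_ifs <;> rfl

theorem opP_opB_comm (a b : ℕ) : opP A a b * opB p = opB p * opP A a b := by
  ext f s
  simp only [Module.End.mul_apply, opP_apply, opB_apply, State.col_flip]
  by_cases h : s.col a = s.col b <;> simp [h]

/-- The correction in `opT` is present only if positions i and i+1 have the same color, and then the
transposition does not change the color read at any position. -/
theorem opP_opT (a b i : ℕ) : opP A a b * opT q i =
    opT q i * opP A (Equiv.swap i (i + 1) a) (Equiv.swap i (i + 1) b) := by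
  ext f s
  have h (c : ℕ) (hc : s.col i = s.col (i + 1)) : s.col (Equiv.swap i (i + 1) c) = s.col c := by
    rw [Equiv.swap_apply_def]
    split_ifs with h1 h2
    · rw [h1, hc]
    · rw [h2, hc]
    · rfl
  simp only [Module.End.mul_apply, opP_apply, opT_apply, State.col_swap, Equiv.swap_apply_self]
  by_cases hc : s.col i = s.col (i + 1)
  · rw [h a hc, h b hc]
    split_ifs <;> simp
  · simp [hc]

end Operators

/-! ### The representation of the algebra -/

section Representation

variable {A : Type*} [CommRing A]

theorem opP_symm (a b : ℕ) : opP A a b = opP A b a := by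
  ext f s
  simp only [opP_apply, eq_comm]

/-- Products of color projections see only the color equalities they impose, which settles the
relations between the E_i and F_j. -/
theorem opP_mul_congr {a b c d a' b' c' d' : ℕ}
    (h : ∀ x : ℕ → ℕ, x a = x b ∧ x c = x d ↔ x a' = x b' ∧ x c' = x d') :
    opP A a b * opP A c d = opP A a' b' * opP A c' d' := by
  ext f s
  simp only [Module.End.mul_apply, opP_apply, ← ite_and, h]

theorem opP_succ_opT (q : A) (i : ℕ) :
    opP A (i + 1) (i + 1 + 1) * opT q i = opT q i * opP A i (i + 1 + 1) := by
  rw [opP_opT, Equiv.swap_apply_right, Equiv.swap_apply_of_ne_of_ne (by omega) (by omega)]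

theorem opP_opT_succ (q : A) (i : ℕ) :
    opP A i (i + 1) * opT q (i + 1) = opT q (i + 1) * opP A i (i + 1 + 1) := by
  rw [opP_opT, Equiv.swap_apply_left, Equiv.swap_apply_of_ne_of_ne (by omega) (by omega)]

theorem opP_opT_self (q : A) (i : ℕ) :
    opP A i (i + 1) * opT q i = opT q i * opP A i (i + 1) := by
  rw [opP_opT, Equiv.swap_apply_left, Equiv.swap_apply_right, opP_symm]

theorem eq_or_eq_of_abs_sub_eq_one {i j : ℕ} (h : |(i : ℤ) - j| = 1) : j = i + 1 ∨ i = j + 1 := by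
  rcases (abs_eq (by norm_num)).1 h with h | h <;> omega

/-- The operators of the generators. -/
noncomputable def opGen (n : ℕ) : Gen n → Module.End K (State → K)
  | .B => opB (v - v⁻¹)
  | .T i _ => opT (u - u⁻¹) i
  | .E i _ => opP K i (i + 1)
  | .F j _ => opP K j 0

theorem lift_opGen_rel {n : ℕ} (hn : 1 ≤ n) {x y : Free n} (h : Rel n x y) :
    FreeAlgebra.lift K (opGen n) x = FreeAlgebra.lift K (opGen n) y := by
  have hb : FreeAlgebra.lift K (opGen n) (Free.b n) = opB (v - v⁻¹) := by simp [Free.b, opGen]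
  have ht {i : ℕ} (h : 1 ≤ i ∧ i < n) :
      FreeAlgebra.lift K (opGen n) (Free.t n i) = opT (u - u⁻¹) i := by simp [Free.t, h, opGen]
  have he {i : ℕ} (h : 1 ≤ i ∧ i < n) :
      FreeAlgebra.lift K (opGen n) (Free.e n i) = opP K i (i + 1) := by simp [Free.e, h, opGen]
  have hf {i : ℕ} (h : 1 ≤ i ∧ i ≤ n) :
      FreeAlgebra.lift K (opGen n) (Free.f n i) = opP K i 0 := by simp [Free.f, h, opGen]
  cases h with
  | commT i j hi hj h =>
    simp only [map_mul, ht hi, ht hj]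
    exact opT_comm _ (by rw [lt_abs] at h; omega)
  | braidT i hi =>
    simp only [map_mul, ht (i := i) ⟨hi.1, by omega⟩, ht (i := i + 1) ⟨by omega, hi.2⟩]
    exact opT_braid _ i
  | quadT i hi =>
    simp only [map_mul, map_add, map_one, map_smul, ht hi, he hi]
    exact opT_sq _ i
  | idemE i hi =>
    simp only [map_mul, he hi]
    exact opP_mul_self _ _
  | commE i j hi hj =>
    simp only [map_mul, he hi, he hj]
    exact opP_comm _ _ _ _
  | commET i hi =>
    simp only [map_mul, he hi, ht hi]
    exact opP_opT_self _ i
  | commET' i j hi hj h =>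
    have h' : i + 1 < j ∨ j + 1 < i := by rw [lt_abs] at h; omega
    simp only [map_mul, he hi, ht hj]
    rw [opP_opT, Equiv.swap_apply_of_ne_of_ne (by omega) (by omega),
      Equiv.swap_apply_of_ne_of_ne (by omega) (by omega)]
  | eet i j hi hj h =>
    simp only [map_mul, he hi, he hj, ht hi]
    rcases eq_or_eq_of_abs_sub_eq_one h with rfl | rfl
    · rw [mul_assoc, opP_succ_opT, ← mul_assoc, opP_opT_self, mul_assoc, mul_assoc]
      exact congrArg _ (opP_mul_congr fun x => by grind)
    · rw [mul_assoc, opP_opT_succ, ← mul_assoc, opP_opT_self, mul_assoc, mul_assoc]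
      exact congrArg _ (opP_mul_congr fun x => by grind)
  | tee i j hi hj h =>
    simp only [map_mul, he hi, he hj, ht hi]
    rcases eq_or_eq_of_abs_sub_eq_one h with rfl | rfl
    · rw [opP_succ_opT, mul_assoc, mul_assoc]
      exact congrArg _ (opP_mul_congr fun x => by grind)
    · rw [opP_opT_succ, mul_assoc, mul_assoc]
      exact congrArg _ (opP_mul_congr fun x => by grind)
  | ett i j hi hj h =>
    simp only [map_mul, he hi, he hj, ht hi, ht hj]
    rcases eq_or_eq_of_abs_sub_eq_one h with rfl | rfl
    · rw [opP_opT_succ, mul_assoc, opP_opT, Equiv.swap_apply_left,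
        Equiv.swap_apply_of_ne_of_ne (by omega) (by omega), ← mul_assoc]
    · rw [opP_succ_opT, mul_assoc, opP_opT, Equiv.swap_apply_right,
        Equiv.swap_apply_of_ne_of_ne (by omega) (by omega), ← mul_assoc]
  | braidB h =>
    simp only [map_mul, hb, ht (i := 1) ⟨le_rfl, h⟩]
    exact opB_braid _ _
  | commBT i hi =>
    simp only [map_mul, hb, ht (i := i) ⟨by omega, hi.2⟩]
    exact opB_opT_comm _ _ hi.1
  | quadB =>
    simp only [map_mul, map_add, map_one, map_smul, hb, hf (i := 1) ⟨le_rfl, hn⟩]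
    exact opB_sq _
  | commBE i hi =>
    simp only [map_mul, hb, he hi]
    exact (opP_opB_comm _ _ _).symm
  | idemF i hi =>
    simp only [map_mul, hf hi]
    exact opP_mul_self _ _
  | commBF j hj =>
    simp only [map_mul, hb, hf hj]
    exact (opP_opB_comm _ _ _).symm
  | commFE i j hi hj =>
    simp only [map_mul, hf hi, he hj]
    exact opP_comm _ _ _ _
  | permF i j hi hj =>
    simp only [map_mul, ht hi, hf hj, hf (swap_mem_Icc hi hj)]
    rw [opP_opT, Equiv.swap_apply_of_ne_of_ne (x := 0) (by omega) (by omega)]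
  | efLeft i hi =>
    simp only [map_mul, he hi, hf (i := i) ⟨hi.1, by omega⟩, hf (i := i + 1) ⟨by omega, by omega⟩]
    exact opP_mul_congr fun x => by grind
  | efRight i hi =>
    simp only [map_mul, he hi, hf (i := i) ⟨hi.1, by omega⟩, hf (i := i + 1) ⟨by omega, by omega⟩]
    exact opP_mul_congr fun x => by grind

/-- The representation of the algebra on the functions of the states. -/
noncomputable def rep {n : ℕ} (hn : 1 ≤ n) : Alg n →ₐ[K] Module.End K (State → K) :=
  RingQuot.liftAlgHom K ⟨FreeAlgebra.lift K (opGen n), fun _ _ h => lift_opGen_rel hn h⟩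

section

variable {n : ℕ} (hn : 1 ≤ n)

theorem rep_proj (x : Free n) : rep hn (proj n x) = FreeAlgebra.lift K (opGen n) x :=
  RingQuot.liftAlgHom_mkAlgHom_apply K _ _ x

theorem rep_B : rep hn (B₁ n) = opB (v - v⁻¹) := by
  rw [B₁, rep_proj]; simp [Free.b, opGen]

theorem rep_T {i : ℕ} (h : 1 ≤ i ∧ i < n) : rep hn (T n i) = opT (u - u⁻¹) i := by
  rw [T, rep_proj]; simp [Free.t, h, opGen]

theorem rep_E {i : ℕ} (h : 1 ≤ i ∧ i < n) : rep hn (E n i) = opP K i (i + 1) := by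
  rw [E, rep_proj]; simp [Free.e, h, opGen]

theorem rep_F {i : ℕ} (h : 1 ≤ i ∧ i ≤ n) : rep hn (F n i) = opP K i 0 := by
  rw [F, rep_proj]; simp [Free.f, h, opGen]

theorem rep_Eaux {d i : ℕ} (hi : 1 ≤ i) (hd : i + d < n) :
    rep hn (Eaux n d i) = opP K i (i + d + 1) := by
  induction d generalizing i with
  | zero => exact rep_E hn ⟨hi, hd⟩
  | succ d ih =>
    have hi' : 1 ≤ i ∧ i < n := ⟨hi, by omega⟩
    have h : opT (u - u⁻¹) i * opP K (i + 1) (i + 1 + d + 1) =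
        opP K i (i + (d + 1) + 1) * opT (u - u⁻¹) i := by
      rw [opP_opT, Equiv.swap_apply_left, Equiv.swap_apply_of_ne_of_ne (by omega) (by omega),
        show i + 1 + d + 1 = i + (d + 1) + 1 by omega]
    rw [Eaux, map_mul, map_mul, rep_T hn hi', ih (by omega) (by omega), h, ← rep_T hn hi', mul_assoc,
      ← map_mul, T_mul_Tu_inv, map_one, mul_one]

theorem rep_ee {a b : ℕ} (ha : a ≤ n) (hb : b ≤ n) : rep hn (ee n a b) = opP K a b := by
  wlog hab : a ≤ b generalizing a b
  · rw [ee_comm, opP_symm]; exact this hb ha (by omega)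
  rcases hab.eq_or_lt with rfl | hab
  · rw [ee_self, map_one]
    ext f s
    simp [opP_apply]
  rcases Nat.eq_zero_or_pos a with rfl | ha0
  · rw [ee_zero_left hab, rep_F hn ⟨hab, hb⟩, opP_symm]
  obtain ⟨d, rfl⟩ : ∃ d, b = a + d + 1 := ⟨b - a - 1, by omega⟩
  rw [ee_Eaux ha0, rep_Eaux hn ha0 (by omega)]

/-- A coloring of the indices is compatible with `I` if it is constant on the blocks of `I`. -/
def Compat (I : P₀ n) (c : ℕ → ℕ) : Prop := ∀ a ≤ n, ∀ b ∈ I.part a, c a = c b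

open Classical in
theorem rep_EF (I : P₀ n) (f : State → K) (s : State) :
    rep hn (EF I) f s = if Compat I s.col then f s else 0 := by
  split_ifs with h
  · have key : ∀ x ∈ blockMonoid I, ∀ g : State → K, rep hn x g s = g s := by
      intro x hx
      induction hx using Submonoid.closure_induction with
      | mem x hx =>
        obtain ⟨a, b, ha, hb, hab, rfl⟩ := hx
        intro g
        rw [rep_ee hn ha hb, opP_apply, if_pos (h a ha b hab)]
      | one => intro g; simp
      | mul x y _ _ hx hy => intro g; rw [map_mul, Module.End.mul_apply, hx, hy]
    exact key _ (EF_mem_blockMonoid I) f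
  · simp only [Compat, not_forall] at h
    obtain ⟨a, ha, b, hab, hne⟩ := h
    rw [← ee_mul_EF ha hab, map_mul, Module.End.mul_apply, rep_ee hn ha (le_of_mem_part hab),
      opP_apply, if_neg hne]

end

end Representation

/-! ### Labels (j,ε) for the elements of M_k, and their operators -/

section Words

variable {A : Type*} [CommRing A] (q p : A)

/-- The operator of `T_i⁻¹`. -/
def opTinv (q : A) (i : ℕ) : Module.End A (State → A) := opT q i - q • opP A i (i + 1)

/-- The operator of `B_{j+1}`. -/
def opBk (q p : A) : ℕ → Module.End A (State → A)
  | 0 => opB p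
  | j + 1 => opT q (j + 1) * opBk q p j * opTinv q (j + 1)

/-- The elements `T_{j+d} ⋯ T_{j+1}` and `T_{j+d} ⋯ T_{j+1} B_{j+1}` of `M_{j+d+1}`. -/
noncomputable def mel (n j : ℕ) (ε : Bool) : ℕ → Alg n
  | 0 => if ε then Bk n (j + 1) else 1
  | d + 1 => T n (j + d + 1) * mel n j ε d

/-- The operator of `mel n j ε d`. -/
def opMel (q p : A) (j : ℕ) (ε : Bool) : ℕ → Module.End A (State → A)
  | 0 => if ε then opBk q p j else 1
  | d + 1 => opT q (j + d + 1) * opMel q p j ε d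

/-- The operator of the product of the `mel n (ℓ k).1 (ℓ k).2 (k - (ℓ k).1)`. -/
def opProd (q p : A) (ℓ : ℕ → ℕ × Bool) : ℕ → Module.End A (State → A)
  | 0 => 1
  | k + 1 => opProd q p ℓ k * opMel q p (ℓ k).1 (ℓ k).2 (k - (ℓ k).1)

theorem mel_mem_M (n j : ℕ) (ε : Bool) (d : ℕ) : mel n j ε d ∈ M n (j + d + 1) := by
  induction d with
  | zero =>
    cases ε
    · exact one_mem_M j
    · exact Bk_mem_M j
  | succ d ih => exact Or.inr ⟨_, ih, rfl⟩

theorem exists_eq_mel {n k : ℕ} {x : Alg n} (hx : x ∈ M n (k + 1)) :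
    ∃ j ≤ k, ∃ ε, x = mel n j ε (k - j) := by
  induction k generalizing x with
  | zero =>
    rcases hx with rfl | rfl
    · exact ⟨0, le_rfl, false, rfl⟩
    · exact ⟨0, le_rfl, true, rfl⟩
  | succ k ih =>
    rcases hx with (rfl | rfl) | ⟨y, hy, rfl⟩
    · exact ⟨k + 1, le_rfl, false, by simp [mel]⟩
    · exact ⟨k + 1, le_rfl, true, by simp [mel]⟩
    · obtain ⟨j, hj, ε, rfl⟩ := ih hy
      refine ⟨j, by omega, ε, ?_⟩
      rw [show k + 1 - j = k - j + 1 by omega, mel, show j + (k - j) + 1 = k + 1 by omega]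

section

variable {n : ℕ} (hn : 1 ≤ n)

theorem rep_Tu_inv {i : ℕ} (h : 1 ≤ i ∧ i < n) :
    rep hn (((Tu n i)⁻¹ : (Alg n)ˣ) : Alg n) = opTinv (u - u⁻¹) i := by
  rw [Tu_inv h, map_sub, map_smul, rep_T hn h, rep_E hn h, opTinv]

theorem rep_Bk {j : ℕ} (hj : j < n) :
    rep hn (Bk n (j + 1)) = opBk (u - u⁻¹) (v - v⁻¹) j := by
  induction j with
  | zero => exact rep_B hn
  | succ j ih =>
    rw [Bk, map_mul, map_mul, rep_T hn ⟨by omega, hj⟩, ih (by omega),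
      rep_Tu_inv hn ⟨by omega, hj⟩, opBk]

theorem rep_mel {j d : ℕ} (ε : Bool) (hd : j + d < n) :
    rep hn (mel n j ε d) = opMel (u - u⁻¹) (v - v⁻¹) j ε d := by
  induction d with
  | zero =>
    cases ε
    · simp [mel, opMel]
    · simpa [mel, opMel] using rep_Bk hn hd
  | succ d ih => rw [mel, map_mul, rep_T hn (i := j + d + 1) ⟨by omega, hd⟩, ih (by omega), opMel]

theorem rep_prod_mel {ℓ : ℕ → ℕ × Bool} (hℓ : ∀ k, (ℓ k).1 ≤ k) {k : ℕ} (hk : k ≤ n) :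
    rep hn (List.ofFn fun i : Fin k => mel n (ℓ i).1 (ℓ i).2 (i - (ℓ i).1)).prod =
      opProd (u - u⁻¹) (v - v⁻¹) ℓ k := by
  induction k with
  | zero => simp [opProd]
  | succ k ih =>
    have h := hℓ k
    rw [List.ofFn_succ', List.concat_eq_append, List.prod_append, List.prod_singleton, map_mul,
      opProd, ← rep_mel hn (j := (ℓ k).1) (d := k - (ℓ k).1) _ (by omega), ← ih (by omega)]
    simp

end

end Words

/-! ### Compatibility of the operators with ring homomorphisms -/

section BaseChange

variable {A A' : Type*} [CommRing A] [CommRing A'] (φ : A →+* A') (q p : A)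

theorem map_opT (i : ℕ) (f : State → A) : φ ∘ opT q i f = opT (φ q) i (φ ∘ f) := by
  ext s
  simp only [Function.comp_apply, opT_apply, map_add, apply_ite φ, map_mul, map_zero]

theorem map_opB (f : State → A) : φ ∘ opB p f = opB (φ p) (φ ∘ f) := by
  ext s
  simp only [Function.comp_apply, opB_apply, map_add, apply_ite φ, map_mul, map_zero]

theorem map_opTinv (i : ℕ) (f : State → A) : φ ∘ opTinv q i f = opTinv (φ q) i (φ ∘ f) := by
  ext s
  have h := congrFun (map_opT φ q i f) s
  simp only [Function.comp_apply] at h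
  simp only [opTinv, Function.comp_apply, LinearMap.sub_apply, LinearMap.smul_apply, Pi.sub_apply,
    Pi.smul_apply, smul_eq_mul, map_sub, map_mul, opP_apply, apply_ite φ, map_zero, h]

theorem map_opBk (j : ℕ) (f : State → A) : φ ∘ opBk q p j f = opBk (φ q) (φ p) j (φ ∘ f) := by
  induction j generalizing f with
  | zero => exact map_opB φ p f
  | succ j ih => simp only [opBk, Module.End.mul_apply, map_opT, ih, map_opTinv]

theorem map_opMel (j : ℕ) (ε : Bool) (d : ℕ) (f : State → A) :
    φ ∘ opMel q p j ε d f = opMel (φ q) (φ p) j ε d (φ ∘ f) := by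
  induction d generalizing f with
  | zero =>
    cases ε
    · simp [opMel]
    · simpa [opMel] using map_opBk φ q p j f
  | succ d ih => simp only [opMel, Module.End.mul_apply, map_opT, ih]

theorem map_opProd (ℓ : ℕ → ℕ × Bool) (k : ℕ) (f : State → A) :
    φ ∘ opProd q p ℓ k f = opProd (φ q) (φ p) ℓ k (φ ∘ f) := by
  induction k generalizing f with
  | zero => simp [opProd]
  | succ k ih => simp only [opProd, Module.End.mul_apply, map_opMel, ih]

end BaseChange

/-! ### Specialization q = p = 0: signed permutations -/

section GroupAction

/-- The map of states underlying `opMel 0 0 j ε d`. -/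
def move (j : ℕ) (ε : Bool) : ℕ → State → State
  | 0, s => if ε then s.flip (j + 1) else s
  | d + 1, s => move j ε d (s.swap (j + d + 1))

/-- The map of states underlying `opProd 0 0 ℓ k`. -/
def act (ℓ : ℕ → ℕ × Bool) : ℕ → State → State
  | 0, s => s
  | k + 1, s => move (ℓ k).1 (ℓ k).2 (k - (ℓ k).1) (act ℓ k s)

variable {A : Type*} [CommRing A]

theorem opT_zero (i : ℕ) (f : State → A) (s : State) : opT 0 i f s = f (s.swap i) := by
  simp [opT_apply]

theorem opBk_zero (j : ℕ) (f : State → A) (s : State) :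
    opBk 0 0 j f s = f (s.flip (j + 1)) := by
  induction j generalizing f s with
  | zero => simp [opBk, opB_apply]
  | succ j ih =>
    simp only [opBk, Module.End.mul_apply, opT_zero, ih, opTinv, zero_smul, sub_zero]
    rw [← State.flip_succ_eq]

theorem opMel_zero (j : ℕ) (ε : Bool) (d : ℕ) (f : State → A) (s : State) :
    opMel 0 0 j ε d f s = f (move j ε d s) := by
  induction d generalizing s with
  | zero =>
    cases ε
    · simp [opMel, move]
    · simpa [opMel, move] using opBk_zero j f s
  | succ d ih => rw [opMel, Module.End.mul_apply, opT_zero, ih, move]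

theorem opProd_zero (ℓ : ℕ → ℕ × Bool) (k : ℕ) (f : State → A) (s : State) :
    opProd 0 0 ℓ k f s = f (act ℓ k s) := by
  induction k generalizing f with
  | zero => simp [opProd, act]
  | succ k ih => rw [opProd, Module.End.mul_apply, ih, opMel_zero, act]

theorem move_injective (j : ℕ) (ε : Bool) (d : ℕ) : Function.Injective (move j ε d) := by
  induction d with
  | zero =>
    cases ε
    · exact fun _ _ h => h
    · exact Function.Involutive.injective fun s => s.flip_flip
  | succ d ih => exact ih.comp (Function.Involutive.injective fun s => s.swap_swap)

theorem val_move (j : ℕ) (ε : Bool) (d : ℕ) (s : State) :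
    (move j ε d s).val (j + 1) = if ε then -s.val (j + d + 1) else s.val (j + d + 1) := by
  induction d generalizing s with
  | zero => cases ε <;> simp [move]
  | succ d ih => rw [move, ih, State.val_swap_left, add_assoc j d 1]

theorem val_move_of_lt {j d x : ℕ} (ε : Bool) (s : State) (hx : j + d + 1 < x) :
    (move j ε d s).val x = s.val x := by
  induction d generalizing s with
  | zero =>
    cases ε
    · rfl
    · exact s.val_flip_of_ne (by omega)
  | succ d ih => rw [move, ih _ (by omega), s.val_swap_of_ne (by omega) (by omega)]

theorem val_act_of_lt {ℓ : ℕ → ℕ × Bool} (hℓ : ∀ k, (ℓ k).1 ≤ k) {k x : ℕ} (s : State)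
    (hx : k < x) : (act ℓ k s).val x = s.val x := by
  induction k with
  | zero => rfl
  | succ k ih =>
    have := hℓ k
    rw [act, val_move_of_lt _ _ (by omega), ih (by omega)]

/-- The integer at position k+1 is untouched by the first k moves, and the last one sends it to
position (ℓ k).1 + 1 with the sign given by (ℓ k).2. Absolute values being distinct, the last label
can be read off, and the last move, being injective, cancels. -/
theorem eq_of_act_eq {ℓ ℓ' : ℕ → ℕ × Bool} (hℓ : ∀ k, (ℓ k).1 ≤ k) (hℓ' : ∀ k, (ℓ' k).1 ≤ k)
    {k : ℕ} {s : State} (h : act ℓ k s = act ℓ' k s) : ∀ i < k, ℓ i = ℓ' i := by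
  induction k with
  | zero => intro i hi; omega
  | succ k ih =>
    have h1 := val_move (ℓ k).1 (ℓ k).2 (k - (ℓ k).1) (act ℓ k s)
    have h2 := val_move (ℓ' k).1 (ℓ' k).2 (k - (ℓ' k).1) (act ℓ' k s)
    rw [act, act] at h
    rw [Nat.add_sub_cancel' (hℓ k), val_act_of_lt hℓ _ (by omega), h] at h1
    rw [Nat.add_sub_cancel' (hℓ' k), val_act_of_lt hℓ' _ (by omega)] at h2
    have hj : (ℓ k).1 = (ℓ' k).1 := by
      by_contra hne
      have := (move (ℓ' k).1 (ℓ' k).2 (k - (ℓ' k).1) (act ℓ' k s)).ne_of_ne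
        ((ℓ k).1 + 1) ((ℓ' k).1 + 1) (by omega)
      rw [h1, h2] at this
      split_ifs at this <;> omega
    have hε : (ℓ k).2 = (ℓ' k).2 := by
      have hs := s.val_ne (k + 1)
      rw [hj, h2] at h1
      cases h3 : (ℓ k).2 <;> cases h4 : (ℓ' k).2 <;> simp [h3, h4] at h1 ⊢ <;> omega
    have hk : ℓ k = ℓ' k := Prod.ext hj hε
    rw [hk] at h
    intro i hi
    rcases (Nat.lt_succ_iff.1 hi).eq_or_lt with rfl | hi
    · exact hk
    · exact ih (move_injective _ _ _ h) i hi

end GroupAction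

/-! ### Linear independence by a determinant -/

section Independence

variable {n : ℕ}

/-- The labels of the tuples `(m₁, …, m_n)`. -/
abbrev Label (n : ℕ) : Type := (k : Fin n) → Fin (k + 1) × Bool

/-- A label as a sequence. -/
def Label.seq (ℓ : Label n) (k : ℕ) : ℕ × Bool :=
  if h : k < n then ((ℓ ⟨k, h⟩).1, (ℓ ⟨k, h⟩).2) else (0, false)

theorem Label.seq_le (ℓ : Label n) (k : ℕ) : (ℓ.seq k).1 ≤ k := by
  unfold seq
  split_ifs with h
  · exact Nat.lt_succ_iff.1 (ℓ ⟨k, h⟩).1.2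
  · exact Nat.zero_le k

theorem Label.seq_injective {ℓ ℓ' : Label n} (h : ∀ k < n, ℓ.seq k = ℓ'.seq k) : ℓ = ℓ' := by
  ext k : 1
  have := h k k.2
  simp only [seq, k.2, dif_pos, Fin.eta, Prod.mk.injEq] at this
  exact Prod.ext (Fin.ext this.1) this.2

/-- The tuple `(m₁, …, m_n)` with a given label. -/
noncomputable def Label.tuple (ℓ : Label n) (k : Fin n) : M n (k + 1) :=
  ⟨mel n (ℓ.seq k).1 (ℓ.seq k).2 (k - (ℓ.seq k).1), by
    have h := mel_mem_M n (ℓ.seq k).1 (ℓ.seq k).2 (k - (ℓ.seq k).1)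
    rwa [Nat.add_sub_cancel' (ℓ.seq_le k)] at h⟩

theorem Label.tuple_surjective : Function.Surjective (Label.tuple (n := n)) := by
  intro m
  choose j hj ε h using fun k : Fin n => exists_eq_mel (m k).2
  refine ⟨fun k => (⟨j k, Nat.lt_succ_iff.2 (hj k)⟩, ε k), funext fun k => Subtype.ext ?_⟩
  rw [h k]
  simp [tuple, seq]

/-- The coloring of an index by the least element of its block. -/
noncomputable def blockColor (I : P₀ n) (a : ℕ) : ℕ := sInf (I.part a : Set ℕ)

theorem compat_blockColor_self (I : P₀ n) : Compat I (blockColor I) := by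
  intro a ha b hb
  rw [blockColor, blockColor, part_eq_of_mem_part ha hb]

/-- A color of J is an element of the block it marks, so equal colors force equal blocks of J. -/
theorem le_of_compat_blockColor {I J : P₀ n} (h : Compat I (blockColor J)) : I ≤ J := by
  intro p hp
  obtain ⟨a, ha⟩ := I.nonempty_of_mem_parts hp
  have hpa : I.part a = p := I.part_eq_of_mem hp ha
  have hI : a ∈ Finset.range (n + 1) := I.le hp ha
  refine ⟨J.part a, J.part_mem.2 hI, fun b hb => ?_⟩
  have han : a ≤ n := by simpa [Nat.lt_succ_iff] using hI
  have hb' : b ∈ I.part a := hpa ▸ hb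
  have hbn := le_of_mem_part hb'
  have hc := h a han b hb'
  have h1 : blockColor J a ∈ (J.part a : Set ℕ) := Nat.sInf_mem ⟨a, mem_part_self han⟩
  have h2 : blockColor J b ∈ (J.part b : Set ℕ) := Nat.sInf_mem ⟨b, mem_part_self hbn⟩
  rw [← part_eq_of_mem_part han h1, hc, part_eq_of_mem_part hbn h2]
  exact mem_part_self hbn

/-- The state with the colors `blockColor I` and the integer `i + 1` at position `i`. -/
noncomputable def baseState (I : P₀ n) : State where
  col := blockColor I
  -- Any admissible integers would serve; the shift keeps the value at position 0 nonzero.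
  val i := i + 1
  val_ne i := by omega
  ne_of_ne i j h := by omega

open Classical in
/-- The values at the states `baseState I'`, transformed by the permutation of `ℓ'`, of the
elements with indices `(I, ℓ)`. -/
noncomputable def testMatrix (n : ℕ) {A : Type*} [CommRing A] (q p : A) :
    Matrix (P₀ n × Label n) (P₀ n × Label n) A := fun y x =>
  if Compat x.1 (blockColor y.1) then
    opProd q p x.2.seq n (fun s => if s = act y.2.seq n (baseState y.1) then 1 else 0)
      (baseState y.1) else 0

theorem map_testMatrix {A A' : Type*} [CommRing A] [CommRing A'] (φ : A →+* A') (q p : A) :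
    (testMatrix n q p).map φ = testMatrix n (φ q) (φ p) := by
  classical
  ext y x
  have h := congrFun (map_opProd φ q p x.2.seq n
    (fun s => if s = act y.2.seq n (baseState y.1) then 1 else 0)) (baseState y.1)
  have h' : (φ ∘ fun s => if s = act y.2.seq n (baseState y.1) then (1 : A) else 0) =
      fun s => if s = act y.2.seq n (baseState y.1) then 1 else 0 := by
    ext s
    simp [apply_ite φ]
  rw [h', Function.comp_apply] at h
  simp only [Matrix.map_apply, testMatrix, apply_ite φ, map_zero]
  rw [h]

theorem testMatrix_zero {A : Type*} [CommRing A] (y x : P₀ n × Label n) [Decidable (x.2 = y.2)]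
    [Decidable (Compat x.1 (blockColor y.1))] : testMatrix n (0 : A) 0 y x =
      if Compat x.1 (blockColor y.1) ∧ x.2 = y.2 then 1 else 0 := by
  have h : act x.2.seq n (baseState y.1) = act y.2.seq n (baseState y.1) ↔ x.2 = y.2 :=
    ⟨fun h => Label.seq_injective (eq_of_act_eq x.2.seq_le y.2.seq_le h), fun h => by rw [h]⟩
  simp only [testMatrix, opProd_zero, h]
  split_ifs <;> simp_all

/-- Row (I,ℓ) has 1 on the diagonal and otherwise involves only columns (J,ℓ) with J < I, so a
kernel vector vanishes by induction on I along refinement. -/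
theorem det_testMatrix_zero_ne_zero (F : Type*) [Field F] [DecidableEq (P₀ n × Label n)] :
    (testMatrix n (0 : F) 0).det ≠ 0 := by
  classical
  intro hdet
  obtain ⟨b, hb, h⟩ := Matrix.exists_mulVec_eq_zero_iff.2 hdet
  refine hb (funext fun x => ?_)
  obtain ⟨I, ℓ⟩ := x
  induction I using WellFoundedLT.induction with
  | ind I ih =>
    have h1 := congrFun h (I, ℓ)
    rw [Matrix.mulVec, dotProduct, Finset.sum_eq_single (I, ℓ)] at h1
    · simpa [testMatrix_zero, compat_blockColor_self] using h1
    · rintro ⟨J, m⟩ - hne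
      rw [testMatrix_zero]
      split_ifs with hc
      · obtain ⟨hc, rfl⟩ := hc
        have hlt : J < I := lt_of_le_of_ne (le_of_compat_blockColor hc) (by rintro rfl; exact hne rfl)
        rw [ih J hlt, Pi.zero_apply, mul_zero]
      · rw [zero_mul]
    · intro hI
      exact absurd (Finset.mem_univ _) hI

/-- The determinant is the image of an element of `ℂ[u, v, (uv)⁻¹]` that does not vanish at
`u = v = 1`. -/
theorem det_testMatrix_ne_zero [DecidableEq (P₀ n × Label n)] :
    (testMatrix n (u - u⁻¹) (v - v⁻¹)).det ≠ 0 := by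
  let P := MvPolynomial (Fin 2) ℂ
  let g : P := MvPolynomial.X 0 * MvPolynomial.X 1
  let R := Localization.Away g
  have hinj : Function.Injective (algebraMap P K) := IsFractionRing.injective P K
  have hu : u ≠ 0 := (map_ne_zero_iff _ hinj).2 (MvPolynomial.X_ne_zero 0)
  have hv : v ≠ 0 := (map_ne_zero_iff _ hinj).2 (MvPolynomial.X_ne_zero 1)
  have hgK : IsUnit (algebraMap P K g) := by
    rw [map_mul]
    exact (mul_ne_zero hu hv).isUnit
  have hgC : IsUnit (MvPolynomial.eval (fun _ => (1 : ℂ)) g) := by simp [g]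
  let φ : R →+* K := IsLocalization.Away.lift g hgK
  let ψ : R →+* ℂ := IsLocalization.Away.lift g hgC
  have hφ (x : P) : φ (algebraMap P R x) = algebraMap P K x := IsLocalization.Away.lift_eq g hgK x
  have hψ (x : P) : ψ (algebraMap P R x) = MvPolynomial.eval (fun _ => (1 : ℂ)) x :=
    IsLocalization.Away.lift_eq g hgC x
  have hinv (i : Fin 2) : ∃ w : R, algebraMap P R (MvPolynomial.X i) * w = 1 := by
    have h : IsUnit (algebraMap P R g) := IsLocalization.Away.algebraMap_isUnit g
    rw [map_mul, IsUnit.mul_iff] at h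
    fin_cases i
    · exact h.1.exists_right_inv
    · exact h.2.exists_right_inv
  obtain ⟨w₀, hw₀⟩ := hinv 0
  obtain ⟨w₁, hw₁⟩ := hinv 1
  have hφw {i : Fin 2} {w : R} (h : algebraMap P R (MvPolynomial.X i) * w = 1) :
      φ w = (algebraMap P K (MvPolynomial.X i))⁻¹ := by
    refine eq_inv_of_mul_eq_one_right ?_
    rw [← hφ, ← map_mul, h, map_one]
  have hψw {i : Fin 2} {w : R} (h : algebraMap P R (MvPolynomial.X i) * w = 1) : ψ w = 1 := by
    have := congrArg ψ h
    rwa [map_mul, hψ, MvPolynomial.eval_X, one_mul, map_one] at this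
  -- Here w₀ and w₁ invert the two variables in R, so φ sends the parameters to u − u⁻¹ and v − v⁻¹,
  -- and ψ sends both to 0.
  let Z := testMatrix n (algebraMap P R (MvPolynomial.X 0) - w₀)
    (algebraMap P R (MvPolynomial.X 1) - w₁)
  have hZK : φ Z.det = (testMatrix n (u - u⁻¹) (v - v⁻¹)).det := by
    rw [RingHom.map_det, RingHom.mapMatrix_apply, map_testMatrix, map_sub, map_sub, hφ, hφ,
      hφw hw₀, hφw hw₁]
    rfl
  have hZC : ψ Z.det ≠ 0 := by
    rw [RingHom.map_det, RingHom.mapMatrix_apply, map_testMatrix, map_sub, map_sub, hψ, hψ,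
      hψw hw₀, hψw hw₁, MvPolynomial.eval_X, MvPolynomial.eval_X, sub_self]
    exact det_testMatrix_zero_ne_zero ℂ
  rw [← hZK]
  intro h0
  -- Clearing denominators, det Z = x/y with x a polynomial; if φ kills it then x = 0, so det Z = 0,
  -- against its nonzero image under ψ.
  obtain ⟨⟨x, y⟩, hxy⟩ := IsLocalization.surj (Submonoid.powers g) Z.det
  refine hZC ?_
  have h1 : algebraMap P K x = 0 := by
    rw [← hφ, ← hxy, map_mul, h0, zero_mul]
  have h2 : x = 0 := (map_eq_zero_iff _ hinj).1 h1
  have h3 : IsUnit (algebraMap P R y) := IsLocalization.map_units R y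
  have h4 : Z.det = 0 := by
    rw [h2, map_zero] at hxy
    exact (h3.mul_left_eq_zero).1 hxy
  rw [h4, map_zero]

/-- The elements of the spanning set, with the labels as indices. -/
noncomputable def labelElt (n : ℕ) (x : P₀ n × Label n) : Alg n := elt n (x.1, x.2.tuple)

theorem rep_labelElt (hn : 1 ≤ n) (x y : P₀ n × Label n) [DecidableEq State] :
    rep hn (labelElt n x) (fun s => if s = act y.2.seq n (baseState y.1) then 1 else 0)
      (baseState y.1) = testMatrix n (u - u⁻¹) (v - v⁻¹) y x := by
  classical
  have h : rep hn (List.ofFn fun k : Fin n => (x.2.tuple k : Alg n)).prod =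
      opProd (u - u⁻¹) (v - v⁻¹) x.2.seq n := rep_prod_mel hn x.2.seq_le le_rfl
  rw [labelElt, elt, map_mul, Module.End.mul_apply, rep_EF, h, testMatrix]
  congr!

/-- Applying a linear relation to each test function and evaluating at the matching base state
yields a kernel vector of the test matrix. -/
theorem linearIndependent_labelElt (hn : 1 ≤ n) : LinearIndependent K (labelElt n) := by
  classical
  rw [Fintype.linearIndependent_iff]
  intro b hb
  refine congrFun (Matrix.eq_zero_of_mulVec_eq_zero (det_testMatrix_ne_zero (n := n)) ?_)
  ext y
  have h := congrArg (fun z => rep hn z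
    (fun s => if s = act y.2.seq n (baseState y.1) then 1 else 0) (baseState y.1)) hb
  simp only [map_sum, map_smul, LinearMap.sum_apply, Finset.sum_apply, LinearMap.smul_apply,
    Pi.smul_apply, rep_labelElt, map_zero, LinearMap.zero_apply, Pi.zero_apply, smul_eq_mul] at h
  rw [Matrix.mulVec, dotProduct, Pi.zero_apply, ← h]
  exact Finset.sum_congr rfl fun x _ => mul_comm _ _

end Independence

end BTB

theorem mainTheorem9 (n : ℕ) (hn : 1 ≤ n) :
    LinearIndepOn BTB.K id (BTB.C n) ∧ Submodule.span BTB.K (BTB.C n) = ⊤ ∧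
      Function.Injective (BTB.elt n) := by
  have hli := BTB.linearIndependent_labelElt hn
  have hsurj : Function.Surjective (Prod.map id BTB.Label.tuple :
      BTB.P₀ n × BTB.Label n → BTB.P₀ n × ((k : Fin n) → BTB.M n (k + 1))) :=
    Function.surjective_id.prodMap BTB.Label.tuple_surjective
  have hcomp : BTB.labelElt n = BTB.elt n ∘ Prod.map id BTB.Label.tuple := rfl
  refine ⟨?_, BTB.span_C hn, ?_⟩
  · have h := hli.linearIndepOn_id
    rwa [hcomp, hsurj.range_comp] at h
  -- `labelElt` is injective and factors as `elt` after a surjection from the labels, so `elt` is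
  -- injective too.
  · have h := hli.injective
    rw [hcomp] at h
    exact h.of_comp_right hsurj
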